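/- Let $n\ge 0$, $\hbar>0$, $J=\begin{pmatrix}0&1\\-1&0\end{pmatrix}$ (in $n\times n$ blocks), and let $\hat Q_j$ (multiplication by $x_j$) and $\hat P_j=-i\hbar\,\partial_{x_j}$ be the position and momentum operators on $L^2(\mathbb R^n)$, $\hat Z=(\hat Q,\hat P)$. For $z=(q,p)\in\mathbb R^{2n}$ let $$\hat T(z)=\exp\Big(\tfrac{i}{\hbar}(p\cdot\hat Q-q\cdot\hat P)\Big),\qquad (\hat T(z)f)(x)=e^{\frac i\hbar (p\cdot x-\frac12 p\cdot q)}f(x-q),$$ be the Weyl–Heisenberg operators. For a real symplectic $2n\times 2n$ matrix $M$, a metaplectic operator $\hat R(M)$ is a unitary operator on $L^2(\mathbb R^n)$ obtained as follows: take a $C^1$ path $F_t$, $t\in[0,1]$, of symplectic matrices with $F_0=1$, $F_1=M$, put $S_t=-J\dot F_tF_t^{-1}$ (so that $\dot F_t=JS_tF_t$), let $U_t$ be the quantum propagator of $\hat H_t=\frac12\hat Z\cdot S_t\hat Z$ (unitary operators with $U_0=1$ that preserve the Schwartz space and satisfy there $i\hbar\,\frac{d}{dt}U_t=\hat H_tU_t$,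 the derivative being strong in $L^2$), and set $\hat R(M)=U_1$. A function $\Omega:\mathbb R^{2n}\to\mathbb C$ is a covariant symbol of a bounded operator $\hat B$ on $L^2(\mathbb R^n)$ if $\hat B=(2\pi\hbar)^{-n}\int_{\mathbb R^{2n}}\Omega(z)\,\hat T(z)\,dz$ in the weak sense: for all Schwartz functions $f,g$, the function $z\mapsto\Omega(z)\langle f,\hat T(z)g\rangle$ is integrable and $\langle f,\hat Bg\rangle=(2\pi\hbar)^{-n}\int_{\mathbb R^{2n}}\Omega(z)\langle f,\hat T(z)g\rangle\,dz$. Theorem 2.2 (Mehlig–Wilkinson formula). Let $M$ be a real symplectic $2n\times2n$ matrix that does not have $1$ as an eigenvalue, and let $\hat R(M)$ be a metaplectic operator of $M$. Then the matrix $$A=\frac J2\,(M-1)^{-1}(1+M)$$ is symmetric, and there is $\gamma_M\in\mathbb C$ with $|\gamma_M|=1$ such that $$\Omega(z)=\frac{\gamma_M}{|\det(1-M)|^{1/2}}\exp\Big(\frac{i}{2\hbar}\,z\cdot Az\Big),\qquad z\in\mathbb R^{2n},$$ is a covariant symbol of $\hat R(M)$, and every covariant symbol of $\hat R(M)$ equals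 $\Omega$ almost everywhere. -/

import Mathlib

open MeasureTheory
open scoped SchwartzMap LineDeriv Matrix

noncomputable section

namespace MehligWilkinson

/-! ### Spaces -/

/-- Configuration space `ℝⁿ`. -/
abbrev Config (n : ℕ) : Type := EuclideanSpace ℝ (Fin n)

/-- Phase space `ℝ²ⁿ`; a point is `z = (q, p)` with `q j = z (Sum.inl j)`, `p j = z (Sum.inr j)`.
The measure `dz` is Lebesgue measure, that is `volume`. -/
abbrev Phase (n : ℕ) : Type := Fin n ⊕ Fin n → ℝ

/-- Real `2n × 2n` matrices in `n × n` blocks, acting on `z = (q, p)`. -/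
abbrev PhaseMatrix (n : ℕ) : Type := Matrix (Fin n ⊕ Fin n) (Fin n ⊕ Fin n) ℝ

/-- The Hilbert space of quantum states `L²(ℝⁿ; ℂ)`. -/
abbrev QState (n : ℕ) : Type := Lp ℂ 2 (volume : Measure (Config n))

/-- A Schwartz function, seen as a quantum state. -/
abbrev state {n : ℕ} (f : 𝓢(Config n, ℂ)) : QState n := f.toLp 2 volume

/-- The symplectic matrix `J = (0, 1; -1, 0)`. It is the negative of `Matrix.J`, so that
`Matrix.symplecticGroup` is the group of the matrices `M` that preserve `σ(z, z') = z ⬝ J z'`. -/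
def J (n : ℕ) : PhaseMatrix n := Matrix.fromBlocks 0 1 (-1) 0

/-! ### Canonical operators and quadratic Hamiltonians -/

/-- The position operator `Q_j`, multiplication by `x_j`, on Schwartz functions. -/
def position {n : ℕ} (j : Fin n) : 𝓢(Config n, ℂ) →L[ℂ] 𝓢(Config n, ℂ) :=
  SchwartzMap.smulLeftCLM ℂ (fun x : Config n => ((x j : ℝ) : ℂ))

/-- The momentum operator `P_j = -i ħ ∂_j` on Schwartz functions. -/
def momentum {n : ℕ} (ħ : ℝ) (j : Fin n) : 𝓢(Config n, ℂ) →L[ℂ] 𝓢(Config n, ℂ) :=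
  (-Complex.I * (ħ : ℂ)) •
    LineDeriv.lineDerivOpCLM ℂ 𝓢(Config n, ℂ) (EuclideanSpace.single j (1 : ℝ))

/-- The `2n` canonical operators `Ẑ = (Q, P)`. -/
def canonical {n : ℕ} (ħ : ℝ) : Fin n ⊕ Fin n → (𝓢(Config n, ℂ) →L[ℂ] 𝓢(Config n, ℂ))
  | Sum.inl j => position j
  | Sum.inr j => momentum ħ j

/-- The quadratic Hamiltonian `½ Ẑ ⬝ S Ẑ` on Schwartz functions. -/
def quadraticHamiltonian {n : ℕ} (ħ : ℝ) (S : PhaseMatrix n) (f : 𝓢(Config n, ℂ)) :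
    𝓢(Config n, ℂ) :=
  (1 / 2 : ℂ) • ∑ a, ∑ b, ((S a b : ℝ) : ℂ) • canonical ħ a (canonical ħ b f)

/-! ### Metaplectic operators -/

/-- `U t` (`0 ≤ t ≤ 1`) is the quantum propagator of the time-dependent Hamiltonian
`½ Ẑ ⬝ S(t) Ẑ`: a family of unitary operators with `U 0 = 1` that leaves the Schwartz space (the
common core of the quadratic Hamiltonians) invariant and satisfies there the Schrödinger equation
`i ħ dU/dt = ½ (Ẑ ⬝ S(t) Ẑ) U`, the derivative being taken in the norm of `L²`
(one-sided at the ends of the interval). -/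
structure IsPropagator {n : ℕ} (ħ : ℝ) (S : ℝ → PhaseMatrix n)
    (U : ℝ → (QState n ≃ₗᵢ[ℂ] QState n)) : Prop where
  initial : ∀ f : QState n, U 0 f = f
  schrodinger : ∀ t ∈ Set.Icc (0 : ℝ) 1, ∀ f : 𝓢(Config n, ℂ), ∃ g : 𝓢(Config n, ℂ),
    U t (state f) = state g ∧
      HasDerivWithinAt (fun s => U s (state f))
        ((-Complex.I / (ħ : ℂ)) • state (quadraticHamiltonian ħ (S t) g)) (Set.Icc 0 1) t

/-- `F` is a `C¹` path of symplectic matrices, with derivative `F'`, from `1` to `M`, with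
parameter in `[0, 1]`. -/
structure IsSymplecticPath {n : ℕ} (M : PhaseMatrix n) (F F' : ℝ → PhaseMatrix n) : Prop where
  source : F 0 = 1
  target : F 1 = M
  symplectic : ∀ t ∈ Set.Icc (0 : ℝ) 1, F t ∈ Matrix.symplecticGroup (Fin n) ℝ
  hasDeriv : ∀ t ∈ Set.Icc (0 : ℝ) 1, ∀ a b,
    HasDerivWithinAt (fun s => F s a b) (F' t a b) (Set.Icc 0 1) t
  continuous_deriv : ∀ a b, ContinuousOn (fun s => F' s a b) (Set.Icc 0 1)

/-- `R` is a metaplectic operator `R̂(M)`: the value `U₁` at time `1` of the quantum propagator of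
the quadratic Hamiltonian whose linear Hamiltonian flow `F t`, `dF/dt = J S(t) F`, that is
`S(t) = -J F'(t) (F t)⁻¹`, is a `C¹` path of symplectic matrices from `1` to `M`. -/
def IsMetaplecticOperator {n : ℕ} (ħ : ℝ) (M : PhaseMatrix n)
    (R : QState n ≃ₗᵢ[ℂ] QState n) : Prop :=
  ∃ (F F' : ℝ → PhaseMatrix n) (U : ℝ → (QState n ≃ₗᵢ[ℂ] QState n)),
    IsSymplecticPath M F F' ∧
    IsPropagator ħ (fun t => -(J n * F' t * (F t)⁻¹)) U ∧
    U 1 = R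

/-! ### Weyl-Heisenberg operators -/

/-- The position part `q` of `z = (q, p)`. -/
def qPart {n : ℕ} (z : Phase n) : Config n := WithLp.toLp 2 (fun j => z (Sum.inl j))

/-- The momentum part `p` of `z = (q, p)`. -/
def pPart {n : ℕ} (z : Phase n) : Config n := WithLp.toLp 2 (fun j => z (Sum.inr j))

/-- The action of `exp (i (p ⬝ Q - q ⬝ P) / ħ)` on functions:
`(T(q, p) f)(x) = exp ((i / ħ) (p ⬝ x - p ⬝ q / 2)) f (x - q)`. -/
def weylFun {n : ℕ} (ħ : ℝ) (z : Phase n) (f : Config n → ℂ) (x : Config n) : ℂ :=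
  Complex.exp (Complex.I / (ħ : ℂ) *
    ((∑ j, pPart z j * x j - (∑ j, pPart z j * qPart z j) / 2 : ℝ) : ℂ)) * f (x - qPart z)

theorem norm_weylFun {n : ℕ} (ħ : ℝ) (z : Phase n) (f : Config n → ℂ) (x : Config n) :
    ‖weylFun ħ z f x‖ = ‖f (x - qPart z)‖ := by
  have h : ∀ r : ℝ, Complex.I / (ħ : ℂ) * (r : ℂ) = ((r / ħ : ℝ) : ℂ) * Complex.I := by
    intro r; push_cast; ring
  rw [weylFun, h, norm_mul, Complex.norm_exp_ofReal_mul_I, one_mul]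

theorem aestronglyMeasurable_weylFun {n : ℕ} (ħ : ℝ) (z : Phase n) {f : Config n → ℂ}
    (hf : AEStronglyMeasurable f volume) : AEStronglyMeasurable (weylFun ħ z f) volume := by
  refine AEStronglyMeasurable.mul (Continuous.aestronglyMeasurable (by fun_prop)) ?_
  exact hf.comp_measurePreserving (measurePreserving_sub_right volume (qPart z))

theorem eLpNorm_weylFun {n : ℕ} (ħ : ℝ) (z : Phase n) {f : Config n → ℂ}
    (hf : AEStronglyMeasurable f volume) :
    eLpNorm (weylFun ħ z f) 2 volume = eLpNorm f 2 volume := by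
  rw [← eLpNorm_comp_measurePreserving hf (measurePreserving_sub_right volume (qPart z))]
  exact eLpNorm_congr_norm_ae (Filter.Eventually.of_forall fun x => norm_weylFun ħ z f x)

theorem memLp_weylFun {n : ℕ} (ħ : ℝ) (z : Phase n) (f : QState n) :
    MemLp (weylFun ħ z f) 2 volume :=
  ⟨aestronglyMeasurable_weylFun ħ z (Lp.aestronglyMeasurable f),
    by rw [eLpNorm_weylFun ħ z (Lp.aestronglyMeasurable f)]; exact Lp.eLpNorm_lt_top f⟩

/-- If two functions agree almost everywhere, so do their images. -/
theorem weylFun_congr {n : ℕ} (ħ : ℝ) (z : Phase n) {f g : Config n → ℂ}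
    (h : f =ᵐ[volume] g) : weylFun ħ z f =ᵐ[volume] weylFun ħ z g := by
  have := (measurePreserving_sub_right volume (qPart z)).quasiMeasurePreserving.ae_eq_comp h
  filter_upwards [this] with x hx
  simp only [Function.comp_apply] at hx
  simp only [weylFun, hx]

/-- The Weyl-Heisenberg operator `T̂(z) = exp (i (p ⬝ Q - q ⬝ P) / ħ)`, `z = (q, p)`,
on `L²(ℝⁿ)`. -/
def weylHeisenberg {n : ℕ} (ħ : ℝ) (z : Phase n) : QState n →ₗᵢ[ℂ] QState n where
  toFun f := (memLp_weylFun ħ z f).toLp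
  map_add' f g := by
    rw [← MemLp.toLp_add, MemLp.toLp_eq_toLp_iff]
    refine (weylFun_congr ħ z (Lp.coeFn_add f g)).trans (Filter.Eventually.of_forall fun x => ?_)
    simp only [weylFun, Pi.add_apply]; ring
  map_smul' c f := by
    rw [RingHom.id_apply, ← MemLp.toLp_const_smul, MemLp.toLp_eq_toLp_iff]
    refine (weylFun_congr ħ z (Lp.coeFn_smul c f)).trans (Filter.Eventually.of_forall fun x => ?_)
    simp only [weylFun, Pi.smul_apply, smul_eq_mul]; ring
  norm_map' f := by
    change ‖(memLp_weylFun ħ z f).toLp‖ = _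
    rw [Lp.norm_toLp, eLpNorm_weylFun ħ z (Lp.aestronglyMeasurable f), Lp.norm_def]

/-- The operators `weylFun ħ (s • z)`, `s ∈ ℝ`, form a one-parameter group. -/
theorem weylFun_add_smul {n : ℕ} (ħ : ℝ) (z : Phase n) (s t : ℝ) (f : Config n → ℂ) :
    weylFun ħ ((s + t) • z) f = weylFun ħ (s • z) (weylFun ħ (t • z) f) := by
  have hq : ∀ r : ℝ, qPart (r • z) = r • qPart z := fun r => rfl
  have hp : ∀ r : ℝ, pPart (r • z) = r • pPart z := fun r => rfl
  funext x
  simp only [weylFun, ← mul_assoc, ← Complex.exp_add, hq, hp]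
  rw [show x - (s + t) • qPart z = x - s • qPart z - t • qPart z by
    rw [add_smul]; abel]
  congr 2
  rw [← mul_add, ← Complex.ofReal_add]
  congr 2
  simp only [PiLp.smul_apply, PiLp.sub_apply, smul_eq_mul, Finset.sum_div,
    ← Finset.sum_sub_distrib, ← Finset.sum_add_distrib]
  refine Finset.sum_congr rfl fun j _ => ?_
  ring

/-- Its generator is `i (p ⬝ Q - q ⬝ P) / ħ`. -/
theorem hasDerivAt_weylFun {n : ℕ} {ħ : ℝ} (hħ : 0 < ħ) (z : Phase n) (f : 𝓢(Config n, ℂ))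
    (x : Config n) :
    HasDerivAt (fun s : ℝ => weylFun ħ (s • z) f x)
      (Complex.I / (ħ : ℂ) * ∑ j, ((z (Sum.inr j) : ℂ) * position j f x
        - (z (Sum.inl j) : ℂ) * momentum ħ j f x)) 0 := by
  have hq : ∀ r : ℝ, qPart (r • z) = r • qPart z := fun r => rfl
  have hp : ∀ r : ℝ, pPart (r • z) = r • pPart z := fun r => rfl
  have hħ' : (ħ : ℂ) ≠ 0 := by exact_mod_cast hħ.ne'
  set a : ℝ := ∑ j, pPart z j * x j with ha
  set b : ℝ := (∑ j, pPart z j * qPart z j) / 2 with hb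
  have hfun : (fun s : ℝ => weylFun ħ (s • z) f x) = fun s : ℝ =>
      Complex.exp (Complex.I / (ħ : ℂ) * ((s * a - s ^ 2 * b : ℝ) : ℂ)) * f (x - s • qPart z) := by
    funext s
    simp only [weylFun, hq, hp, PiLp.smul_apply, smul_eq_mul, ha, hb]
    congr 5
    · rw [Finset.mul_sum]; exact Finset.sum_congr rfl fun j _ => by ring
    · rw [mul_div_assoc', Finset.mul_sum]
      congr 1; exact Finset.sum_congr rfl fun j _ => by ring
  have h1 : HasDerivAt (fun s : ℝ => s * a - s ^ 2 * b) a 0 := by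
    have := ((hasDerivAt_id (0 : ℝ)).mul_const a).sub ((hasDerivAt_pow 2 (0 : ℝ)).mul_const b)
    refine this.congr_deriv ?_
    simp
  have h2 : HasDerivAt (fun s : ℝ => f (x - s • qPart z)) (-(fderiv ℝ f x (qPart z))) 0 := by
    have hl : HasDerivAt (fun s : ℝ => x - s • qPart z) (-qPart z) 0 := by
      simpa using ((hasDerivAt_id (0 : ℝ)).smul_const (qPart z)).const_sub x
    have hf : HasFDerivAt f (fderiv ℝ f x) (x - (0 : ℝ) • qPart z) := by
      simpa using f.differentiableAt.hasFDerivAt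
    exact (hf.comp_hasDerivAt (0 : ℝ) hl).congr_deriv (map_neg _ _)
  have h3 := ((h1.ofReal_comp.const_mul (Complex.I / (ħ : ℂ))).cexp).mul h2
  rw [hfun]
  refine h3.congr_deriv ?_
  have hdir : fderiv ℝ f x (qPart z)
      = ∑ j, ((z (Sum.inl j) : ℝ) : ℂ) * fderiv ℝ f x (EuclideanSpace.single j (1 : ℝ)) := by
    have : qPart z = ∑ j, z (Sum.inl j) • EuclideanSpace.single j (1 : ℝ) := by
      ext i
      simp [qPart, Pi.single_apply]
    rw [this, map_sum]
    exact Finset.sum_congr rfl fun j _ => by rw [map_smul, Complex.real_smul]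
  have hpos : ∀ j, position j f x = (x j : ℂ) * f x := by
    intro j
    have : (fun x : Config n => ((x j : ℝ) : ℂ)).HasTemperateGrowth :=
      (Complex.ofRealCLM ∘L EuclideanSpace.proj j).hasTemperateGrowth
    simp [position, this]
  have hmom : ∀ j, momentum ħ j f x
      = -Complex.I * ħ * fderiv ℝ f x (EuclideanSpace.single j (1 : ℝ)) := by
    intro j
    simp [momentum, SchwartzMap.lineDerivOp_apply_eq_fderiv]
  have h0 : ((0 * a - 0 ^ 2 * b : ℝ) : ℂ) = 0 := by simp
  rw [h0, mul_zero, Complex.exp_zero, zero_smul, sub_zero, one_mul, one_mul, hdir]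
  simp only [hpos, hmom, ha, pPart, Complex.ofReal_sum, Complex.ofReal_mul, Finset.mul_sum,
    Finset.sum_mul, ← Finset.sum_neg_distrib, ← Finset.sum_add_distrib]
  refine Finset.sum_congr rfl fun j _ => ?_
  field_simp
  ring_nf
  rw [Complex.I_sq]; ring

/-! ### Covariant symbol -/

/-- `Ω` is a covariant symbol of the operator `R`: `R = (2 π ħ)⁻ⁿ ∫ Ω(z) T̂(z) dz`, as a weak
integral on Schwartz functions, i.e. all the matrix elements `⟨f, ⬝ g⟩` of both sides with
Schwartz `f` and `g` agree, the integrals being absolutely convergent. -/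
def IsCovariantSymbol {n : ℕ} (ħ : ℝ) (R : QState n →L[ℂ] QState n) (Ω : Phase n → ℂ) : Prop :=
  ∀ f g : 𝓢(Config n, ℂ),
    Integrable (fun z => Ω z * inner ℂ (state f) (weylHeisenberg ħ z (state g))) volume ∧
    inner ℂ (state f) (R (state g)) =
      (((2 * Real.pi * ħ) ^ n : ℝ) : ℂ)⁻¹ *
        ∫ z, Ω z * inner ℂ (state f) (weylHeisenberg ħ z (state g))

/-- The matrix `A = (J / 2) (M - 1)⁻¹ (1 + M)`. -/
def cayley {n : ℕ} (M : PhaseMatrix n) : PhaseMatrix n :=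
  (1 / 2 : ℝ) • (J n * (M - 1)⁻¹ * (1 + M))

end MehligWilkinson

end

/-!
Write `T(z)` for the Weyl-Heisenberg operators and `σ(z, w) = Jz ⬝ w`, so that
`T(z) T(w) = exp (i σ(z, w) / 2ħ) T(z + w)`. The proof has four ingredients.

*Covariance*: `R T(z) = T(M z) R` (`IsMetaplecticOperator.map_weylHeisenberg`). With `U` the
propagator and `F` the symplectic path, `⟨U(t) h, T(F(t) z) U(t) f⟩` is constant in time for Schwartz
`h`, `f`: its derivative is a commutator of the quadratic Hamiltonian with `T`, which cancels the
derivative of `T` along the flow because `T(z)⁻¹ Z T(z) = Z + z`.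

*Ambiguity functions* `⟨f, T(z) g⟩` of Schwartz functions are continuous and integrable. Multiplying
one by a coordinate of `z` gives a difference of two others, so that they decay rapidly. They satisfy
Moyal's orthogonality relations `∫ ⟨f, T(z) u⟩ ⟨T(z) v, g⟩ dz = (2πħ)ⁿ ⟨f, g⟩ ⟨v, u⟩`, by Plancherel
in `p` and Fubini.

*Uniqueness*: replacing `f`, `g` by `T(w) f`, `T(w) g` multiplies `⟨f, T(z) g⟩` by
`exp (i σ(z, w) / ħ)`. Hence, if `Ω` is the difference of two symbols, the Fourier transform of
`Ω(z) ⟨f, T(z) g⟩` vanishes identically, and `Ω = 0` almost everywhere.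

*Existence*: by the orthogonality relations,
`(2πħ)ⁿ ⟨v, u⟩ ⟨f, R g⟩ = ∫ ⟨f, R T(w) u⟩ ⟨v, T(-w) g⟩ dw`. Covariance turns the integrand into
`⟨f, T(M w) R u⟩ ⟨v, T(-w) g⟩`, which the orthogonality relations, used backwards, expand into an
integral over `z`. With `y = z + (M - 1) w` one has `T(M w) T(z) T(-w) ∝ T(y)`, and covariance shows
that the integrand is `exp ((i / 2ħ) y ⬝ A y) ⟨f, T(y) g⟩ k(w - (M - 1)⁻¹ y)`, where
`k(w) = ⟨T(w) v, R T(w) u⟩`. As `K = ∫ k` does not see the shift, this gives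
`(2πħ)²ⁿ ⟨v, u⟩ ⟨f, R g⟩ = K ∫ exp ((i / 2ħ) y ⬝ A y) ⟨f, T(y) g⟩ dy`
(`integral_cayleyPhase_mul_ambiguity`). The substitution `y = (M - 1) w` expresses `K` by the complex
conjugate of the integral on the right with `f = R u`, `g = v` (`integral_conjElement`); since `R` is
unitary, this determines the modulus of `K`, and with it the factor `|det (1 - M)| ^ (-1 / 2)`.

The symmetry of `A = J / 2 + J (M - 1)⁻¹` is the identity `Mᵀ J M = J`, multiplied by `(M - 1)⁻¹` on the
right and by its transpose on the left (`isSymm_cayley`).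
-/

noncomputable section

/-! ### Fourier uniqueness and linear substitution -/

/-- The Fourier transform is injective on `L¹`. -/
theorem MeasureTheory.Integrable.ae_eq_zero_of_fourier_eq_zero {V : Type*} [NormedAddCommGroup V]
    [InnerProductSpace ℝ V] [FiniteDimensional ℝ V] [MeasurableSpace V] [BorelSpace V]
    {G : V → ℂ} (hG : Integrable G volume) (h : ∀ ξ, FourierTransform.fourier G ξ = 0) :
    G =ᵐ[volume] 0 := by
  refine ae_eq_zero_of_integral_contDiff_smul_eq_zero hG.locallyIntegrable fun g hg hgc => ?_
  have h1 : HasCompactSupport fun x => (g x : ℂ) := hgc.comp_left Complex.ofReal_zero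
  have h2 : ContDiff ℝ (⊤ : ℕ∞) fun x => (g x : ℂ) := Complex.ofRealCLM.contDiff.comp hg
  set ψ : 𝓢(V, ℂ) := h1.toSchwartzMap h2 with hψ
  have h3 := VectorFourier.integral_fourierIntegral_smul_eq_flip (L := innerₗ V)
    Real.continuous_fourierChar continuous_inner hG
    (FourierTransformInv.fourierInv ψ).integrable (μ := volume) (ν := volume)
  have h4 : ∀ ξ, VectorFourier.fourierIntegral Real.fourierChar volume (innerₗ V) G ξ = 0 := h
  have h5 : ∀ x, VectorFourier.fourierIntegral Real.fourierChar volume (innerₗ V).flip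
      (FourierTransformInv.fourierInv ψ : 𝓢(V, ℂ)) x = ψ x := by
    intro x
    rw [flip_innerₗ]
    change FourierTransform.fourier ((FourierTransformInv.fourierInv ψ : 𝓢(V, ℂ)) : V → ℂ) x = _
    rw [← SchwartzMap.fourier_coe, FourierTransform.fourier_fourierInv_eq]
  simp only [h4, h5, zero_smul, integral_zero] at h3
  rw [h3]
  refine integral_congr_ae (Filter.Eventually.of_forall fun x => ?_)
  simp [hψ, mul_comm]

/-- Linear change of variables for an invertible matrix. -/
theorem Matrix.integrable_comp_mulVec_and_integral {ι : Type*} [Fintype ι] [DecidableEq ι]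
    {B : Matrix ι ι ℝ} (hB : B.det ≠ 0) (G : (ι → ℝ) → ℂ) :
    (Integrable G volume → Integrable (fun w => G (B *ᵥ w)) volume) ∧
      ∫ w, G (B *ᵥ w) = ((|B.det|⁻¹ : ℝ) : ℂ) * ∫ y, G y := by
  have hmap := Real.map_matrix_volume_pi_eq_smul_volume_pi hB
  have hemb : MeasurableEmbedding (Matrix.toLin' B) := by
    have h1 : Function.Injective (Matrix.toLin' B) :=
      Matrix.mulVec_injective_iff_isUnit.2 ((Matrix.isUnit_iff_isUnit_det B).2 hB.isUnit)
    exact (LinearMap.continuous_of_finiteDimensional _).measurableEmbedding h1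
  constructor
  · intro hG
    have h1 : Integrable G (Measure.map (Matrix.toLin' B) volume) := by
      rw [hmap]; exact hG.smul_measure ENNReal.ofReal_ne_top
    exact (hemb.integrable_map_iff).1 h1
  · have h1 := hemb.integral_map (μ := volume) G
    rw [hmap, integral_smul_measure, ENNReal.toReal_ofReal (abs_nonneg _), abs_inv,
      Complex.real_smul] at h1
    exact h1.symm

namespace MehligWilkinson

variable {n : ℕ}

/-! ### The symplectic form and phases -/

/-- The symplectic form `σ(z, w) = Jz ⬝ w = p ⬝ q' - q ⬝ p'`, `z = (q, p)`, `w = (q', p')`. -/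
def sympForm (z w : Phase n) : ℝ := (J n *ᵥ z) ⬝ᵥ w

theorem J_mulVec_inl (z : Phase n) (j : Fin n) : (J n *ᵥ z) (Sum.inl j) = z (Sum.inr j) := by
  simp [J, Matrix.fromBlocks_mulVec]

theorem J_mulVec_inr (z : Phase n) (j : Fin n) : (J n *ᵥ z) (Sum.inr j) = -z (Sum.inl j) := by
  simp [J, Matrix.fromBlocks_mulVec, Matrix.neg_mulVec]

theorem sympForm_eq_sum (z w : Phase n) :
    sympForm z w = ∑ j, (z (Sum.inr j) * w (Sum.inl j) - z (Sum.inl j) * w (Sum.inr j)) := by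
  simp only [sympForm, dotProduct, Fintype.sum_sum_type, J_mulVec_inl, J_mulVec_inr,
    neg_mul, sub_eq_add_neg, Finset.sum_add_distrib]

theorem sympForm_self (z : Phase n) : sympForm z z = 0 := by
  rw [sympForm_eq_sum]
  exact Finset.sum_eq_zero fun j _ => by ring

theorem sympForm_swap (z w : Phase n) : sympForm w z = -sympForm z w := by
  rw [sympForm_eq_sum, sympForm_eq_sum, ← Finset.sum_neg_distrib]
  exact Finset.sum_congr rfl fun j _ => by ring

theorem sympForm_add_left (z z' w : Phase n) :
    sympForm (z + z') w = sympForm z w + sympForm z' w := by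
  simp [sympForm, Matrix.mulVec_add, add_dotProduct]

theorem sympForm_add_right (z w w' : Phase n) :
    sympForm z (w + w') = sympForm z w + sympForm z w' := by
  simp [sympForm]

theorem sympForm_neg_left (z w : Phase n) : sympForm (-z) w = -sympForm z w := by
  simp [sympForm, Matrix.mulVec_neg]

theorem sympForm_neg_right (z w : Phase n) : sympForm z (-w) = -sympForm z w := by
  simp [sympForm]

/-- The phase `exp (i r / 2 ħ)`. The composition law of the Weyl-Heisenberg operators is
`T(z) T(w) = phase (σ(z, w)) T(z + w)`. -/
def phase (ħ r : ℝ) : ℂ := Complex.exp (Complex.I / (2 * (ħ : ℂ)) * (r : ℂ))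

theorem phase_eq (ħ r : ℝ) : phase ħ r = Complex.exp (((r / (2 * ħ) : ℝ) : ℂ) * Complex.I) := by
  rw [phase]; congr 1; push_cast; ring

@[simp] theorem norm_phase (ħ r : ℝ) : ‖phase ħ r‖ = 1 := by
  rw [phase_eq, Complex.norm_exp_ofReal_mul_I]

theorem phase_add (ħ r s : ℝ) : phase ħ (r + s) = phase ħ r * phase ħ s := by
  simp only [phase, ← Complex.exp_add]; congr 1; push_cast; ring

@[simp] theorem phase_zero (ħ : ℝ) : phase ħ 0 = 1 := by simp [phase]

theorem phase_mul_phase_neg (ħ r : ℝ) : phase ħ r * phase ħ (-r) = 1 := by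
  rw [← phase_add, add_neg_cancel, phase_zero]

theorem conj_phase (ħ r : ℝ) : (starRingEnd ℂ) (phase ħ r) = phase ħ (-r) := by
  simp only [phase, ← Complex.exp_conj]
  congr 1
  simp [Complex.conj_ofReal, Complex.conj_ofNat, neg_div]

@[fun_prop]
theorem continuous_phase (ħ : ℝ) : Continuous (phase ħ) := by
  unfold phase; fun_prop

/-! ### Weyl-Heisenberg operators -/

theorem hasTemperateGrowth_cexp_mul_I :
    (fun t : ℝ => Complex.exp ((t : ℂ) * Complex.I)).HasTemperateGrowth := by
  refine ⟨(Complex.ofRealCLM.contDiff.mul contDiff_const).cexp, fun k => ⟨0, 1, fun t => ?_⟩⟩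
  have h : ∀ m, iteratedDeriv m (fun t : ℝ => Complex.exp ((t : ℂ) * Complex.I)) =
      fun t : ℝ => Complex.I ^ m * Complex.exp ((t : ℂ) * Complex.I) := by
    intro m
    induction m with
    | zero => simp
    | succ m ih =>
      rw [iteratedDeriv_succ, ih]
      funext t
      have h1 : HasDerivAt (fun t : ℝ => (t : ℂ) * Complex.I) Complex.I t := by
        simpa using (Complex.ofRealCLM.hasDerivAt (x := t)).mul_const Complex.I
      rw [(h1.cexp.const_mul (Complex.I ^ m)).deriv]
      ring
  rw [norm_iteratedFDeriv_eq_norm_iteratedDeriv, h]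
  simp [Complex.norm_exp_ofReal_mul_I]

/-- The factor `exp ((i / ħ) (p ⬝ x - p ⬝ q / 2))` of `weylFun`. -/
def weylFactor (ħ : ℝ) (z : Phase n) (x : Config n) : ℂ :=
  Complex.exp (Complex.I / (ħ : ℂ) *
    ((∑ j, pPart z j * x j - (∑ j, pPart z j * qPart z j) / 2 : ℝ) : ℂ))

theorem weylFun_eq (ħ : ℝ) (z : Phase n) (f : Config n → ℂ) (x : Config n) :
    weylFun ħ z f x = weylFactor ħ z x * f (x - qPart z) := rfl

theorem hasTemperateGrowth_weylFactor (ħ : ℝ) (z : Phase n) :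
    (weylFactor ħ z).HasTemperateGrowth := by
  have h1 : (fun x : Config n =>
      (∑ j, pPart z j * x j - (∑ j, pPart z j * qPart z j) / 2) / ħ).HasTemperateGrowth := by
    have h2 : ∀ j, (fun x : Config n => x j).HasTemperateGrowth := fun j =>
      (EuclideanSpace.proj (𝕜 := ℝ) j).hasTemperateGrowth
    simp only [div_eq_mul_inv]
    fun_prop
  have h3 := hasTemperateGrowth_cexp_mul_I.comp h1
  have h4 : weylFactor ħ z = (fun t : ℝ => Complex.exp ((t : ℂ) * Complex.I)) ∘ fun x : Config n =>
      (∑ j, pPart z j * x j - (∑ j, pPart z j * qPart z j) / 2) / ħ := by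
    funext x
    simp only [weylFactor, Function.comp]
    congr 1; push_cast; ring
  rwa [h4]

/-- The Weyl-Heisenberg operator `T(z)` on Schwartz functions. -/
def weylSchwartz (ħ : ℝ) (z : Phase n) : 𝓢(Config n, ℂ) →L[ℂ] 𝓢(Config n, ℂ) :=
  SchwartzMap.smulLeftCLM ℂ (weylFactor ħ z) ∘L SchwartzMap.compSubConstCLM ℂ (qPart z)

@[simp] theorem weylSchwartz_apply (ħ : ℝ) (z : Phase n) (f : 𝓢(Config n, ℂ)) (x : Config n) :
    weylSchwartz ħ z f x = weylFun ħ z f x := by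
  simp [weylSchwartz, SchwartzMap.smulLeftCLM_apply_apply (hasTemperateGrowth_weylFactor ħ z),
    weylFun_eq]

theorem coeFn_weylHeisenberg (ħ : ℝ) (z : Phase n) (f : QState n) :
    weylHeisenberg ħ z f =ᵐ[volume] weylFun ħ z f := (memLp_weylFun ħ z f).coeFn_toLp

theorem weylHeisenberg_state (ħ : ℝ) (z : Phase n) (f : 𝓢(Config n, ℂ)) :
    weylHeisenberg ħ z (state f) = state (weylSchwartz ħ z f) := by
  refine Lp.ext ?_
  filter_upwards [coeFn_weylHeisenberg ħ z (state f), weylFun_congr ħ z (f.coeFn_toLp 2 volume),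
    (weylSchwartz ħ z f).coeFn_toLp 2 volume] with x h1 h2 h3
  rw [h1, h2, h3, weylSchwartz_apply]

theorem weylFun_weylFun (ħ : ℝ) (z w : Phase n) (f : Config n → ℂ) (x : Config n) :
    weylFun ħ z (weylFun ħ w f) x = phase ħ (sympForm z w) * weylFun ħ (z + w) f x := by
  have hq : qPart (z + w) = qPart z + qPart w := rfl
  simp only [weylFun, phase, hq, sub_add_eq_sub_sub, ← mul_assoc, ← Complex.exp_add]
  congr 2
  have h : ∀ r : ℝ, Complex.I / (2 * (ħ : ℂ)) * (r : ℂ) = Complex.I / (ħ : ℂ) * ((r / 2 : ℝ) : ℂ) := by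
    intro r; push_cast; ring
  rw [h, ← mul_add, ← mul_add, ← Complex.ofReal_add, ← Complex.ofReal_add]
  congr 2
  rw [sympForm_eq_sum]
  simp only [qPart, pPart, PiLp.sub_apply, PiLp.add_apply, Pi.add_apply, Finset.sum_div,
    ← Finset.sum_sub_distrib, ← Finset.sum_add_distrib]
  exact Finset.sum_congr rfl fun j _ => by ring

theorem weylHeisenberg_comp (ħ : ℝ) (z w : Phase n) (f : QState n) :
    weylHeisenberg ħ z (weylHeisenberg ħ w f) =
      phase ħ (sympForm z w) • weylHeisenberg ħ (z + w) f := by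
  refine Lp.ext ?_
  filter_upwards [coeFn_weylHeisenberg ħ z (weylHeisenberg ħ w f),
    weylFun_congr ħ z (coeFn_weylHeisenberg ħ w f),
    Lp.coeFn_smul (phase ħ (sympForm z w)) (weylHeisenberg ħ (z + w) f),
    coeFn_weylHeisenberg ħ (z + w) f] with x h1 h2 h3 h4
  rw [h1, h2, h3, Pi.smul_apply, h4, weylFun_weylFun, smul_eq_mul]

@[simp] theorem weylHeisenberg_zero (ħ : ℝ) (f : QState n) : weylHeisenberg ħ 0 f = f := by
  refine Lp.ext ?_
  filter_upwards [coeFn_weylHeisenberg ħ 0 f] with x h1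
  have hq : qPart (0 : Phase n) = 0 := rfl
  have hp : pPart (0 : Phase n) = 0 := rfl
  rw [h1, weylFun, hq, hp]
  simp

theorem weylHeisenberg_neg_apply (ħ : ℝ) (z : Phase n) (f : QState n) :
    weylHeisenberg ħ (-z) (weylHeisenberg ħ z f) = f := by
  rw [weylHeisenberg_comp, sympForm_neg_left, sympForm_self]
  simp

theorem weylHeisenberg_apply_neg (ħ : ℝ) (z : Phase n) (f : QState n) :
    weylHeisenberg ħ z (weylHeisenberg ħ (-z) f) = f := by
  simpa using weylHeisenberg_neg_apply ħ (-z) f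

theorem inner_weylHeisenberg_left (ħ : ℝ) (z : Phase n) (f g : QState n) :
    inner ℂ (weylHeisenberg ħ z f) g = inner ℂ f (weylHeisenberg ħ (-z) g) := by
  rw [← (weylHeisenberg ħ (-z)).inner_map_map, weylHeisenberg_neg_apply]

/-! ### Canonical operators -/

@[simp] theorem position_apply (j : Fin n) (f : 𝓢(Config n, ℂ)) (x : Config n) :
    position j f x = (x j : ℂ) * f x := by
  have : (fun x : Config n => ((x j : ℝ) : ℂ)).HasTemperateGrowth :=
    (Complex.ofRealCLM ∘L EuclideanSpace.proj j).hasTemperateGrowth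
  simp [position, this]

@[simp] theorem momentum_apply (ħ : ℝ) (j : Fin n) (f : 𝓢(Config n, ℂ)) (x : Config n) :
    momentum ħ j f x = -Complex.I * ħ * fderiv ℝ f x (EuclideanSpace.single j (1 : ℝ)) := by
  simp [momentum, SchwartzMap.lineDerivOp_apply_eq_fderiv]

theorem hasFDerivAt_weylFactor (ħ : ℝ) (z : Phase n) (x : Config n) :
    HasFDerivAt (weylFactor ħ z) ((weylFactor ħ z x * (Complex.I / (ħ : ℂ))) •
      (Complex.ofRealCLM ∘L ∑ j, pPart z j • (EuclideanSpace.proj j : Config n →L[ℝ] ℝ))) x := by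
  have h1 : HasFDerivAt (fun x : Config n =>
      (∑ j, pPart z j * x j - (∑ j, pPart z j * qPart z j) / 2))
      (∑ j, pPart z j • (EuclideanSpace.proj j : Config n →L[ℝ] ℝ)) x := by
    refine (HasFDerivAt.fun_sum fun j _ => ?_).sub_const _
    exact ((EuclideanSpace.proj j : Config n →L[ℝ] ℝ).hasFDerivAt).const_mul _
  have h2 := (Complex.ofRealCLM.hasFDerivAt.comp x h1)
  have h3 := (h2.const_mul (Complex.I / (ħ : ℂ))).cexp
  refine h3.congr_fderiv ?_
  rw [smul_smul]
  rfl

/-- `T(z)` translates the canonical operators: `T(z)⁻¹ Z T(z) = Z + z`. -/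
theorem canonical_weylSchwartz {ħ : ℝ} (hħ : 0 < ħ) (z : Phase n) (a : Fin n ⊕ Fin n)
    (f : 𝓢(Config n, ℂ)) :
    canonical ħ a (weylSchwartz ħ z f) =
      weylSchwartz ħ z (canonical ħ a f) + (z a : ℂ) • weylSchwartz ħ z f := by
  ext x
  rcases a with j | j
  · simp only [canonical, position_apply, weylSchwartz_apply, add_apply,
      smul_apply, weylFun_eq, smul_eq_mul, qPart, PiLp.sub_apply]
    push_cast; ring
  · have hħ' : (ħ : ℂ) ≠ 0 := by exact_mod_cast hħ.ne'
    have h1 : HasFDerivAt (fun x => f (x - qPart z)) (fderiv ℝ f (x - qPart z)) x := by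
      have := (f.hasFDerivAt (x - qPart z)).comp x ((hasFDerivAt_id x).sub_const (qPart z))
      exact this
    have h2 : (weylSchwartz ħ z f : Config n → ℂ) =
        fun x => weylFactor ħ z x * f (x - qPart z) := by
      funext x; rw [weylSchwartz_apply, weylFun_eq]
    have h3 := (hasFDerivAt_weylFactor ħ z x).fun_mul h1
    simp only [canonical, momentum_apply, weylSchwartz_apply, add_apply,
      smul_apply, weylFun_eq, smul_eq_mul]
    rw [h2, h3.fderiv]
    have h4 : pPart z j = z (Sum.inr j) := rfl
    simp
    rw [h4]
    field_simp
    ring_nf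
    simp [Complex.I_sq]

theorem inner_state (f g : 𝓢(Config n, ℂ)) :
    inner ℂ (state f) (state g) = ∫ x, (starRingEnd ℂ) (f x) * g x := by
  rw [show inner ℂ (state f) (state g) = _ from SchwartzMap.inner_toL2_toL2_eq f g volume]
  exact integral_congr_ae (Filter.Eventually.of_forall fun x => by simp [mul_comm])

/-- The canonical operators are symmetric. -/
theorem inner_canonical_left (ħ : ℝ) (a : Fin n ⊕ Fin n) (f g : 𝓢(Config n, ℂ)) :
    inner ℂ (state (canonical ħ a f)) (state g) =
      inner ℂ (state f) (state (canonical ħ a g)) := by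
  rw [inner_state, inner_state]
  rcases a with j | j
  · refine integral_congr_ae (Filter.Eventually.of_forall fun x => ?_)
    simp [canonical]; ring
  · have h := SchwartzMap.integral_bilinear_lineDerivOp_right_eq_neg_left (μ := volume) f g
      ((ContinuousLinearMap.mul ℝ ℂ).comp (Complex.conjCLE : ℂ →L[ℝ] ℂ))
      (EuclideanSpace.single j (1 : ℝ))
    simp only [ContinuousLinearMap.comp_apply, ContinuousLinearMap.mul_apply',
      SchwartzMap.lineDerivOp_apply_eq_fderiv, ContinuousLinearEquiv.coe_coe,
      Complex.conjCLE_apply] at h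
    calc ∫ x, (starRingEnd ℂ) (canonical ħ (Sum.inr j) f x) * g x
        = Complex.I * ħ * ∫ x, (starRingEnd ℂ) (fderiv ℝ f x (EuclideanSpace.single j 1)) * g x := by
          rw [← integral_const_mul]
          refine integral_congr_ae (Filter.Eventually.of_forall fun x => ?_)
          simp [canonical]; ring
      _ = -Complex.I * ħ * ∫ x, (starRingEnd ℂ) (f x) * fderiv ℝ g x (EuclideanSpace.single j 1) := by
          rw [h]; ring
      _ = ∫ x, (starRingEnd ℂ) (f x) * canonical ħ (Sum.inr j) g x := by
          rw [← integral_const_mul]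
          refine integral_congr_ae (Filter.Eventually.of_forall fun x => ?_)
          simp [canonical]; ring

/-! ### Ambiguity functions and their decay -/

/-- The matrix element `z ↦ ⟨f, T(z) g⟩` (the cross-ambiguity function of `f` and `g`). -/
def ambiguity (ħ : ℝ) (f g : 𝓢(Config n, ℂ)) (z : Phase n) : ℂ :=
  inner ℂ (state f) (weylHeisenberg ħ z (state g))

theorem ambiguity_eq_integral (ħ : ℝ) (f g : 𝓢(Config n, ℂ)) (z : Phase n) :
    ambiguity ħ f g z = ∫ x, (starRingEnd ℂ) (f x) * weylFun ħ z g x := by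
  simp only [ambiguity, weylHeisenberg_state, inner_state, weylSchwartz_apply]

theorem norm_ambiguity_le (ħ : ℝ) (f g : 𝓢(Config n, ℂ)) (z : Phase n) :
    ‖ambiguity ħ f g z‖ ≤ ‖state f‖ * ‖state g‖ := by
  refine (norm_inner_le_norm _ _).trans_eq ?_
  rw [LinearIsometry.norm_map]

theorem state_add (f g : 𝓢(Config n, ℂ)) : state (f + g) = state f + state g :=
  map_add (SchwartzMap.toLpCLM ℂ ℂ 2 (volume : Measure (Config n))) f g

theorem state_smul (c : ℂ) (f : 𝓢(Config n, ℂ)) : state (c • f) = c • state f :=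
  map_smul (SchwartzMap.toLpCLM ℂ ℂ 2 (volume : Measure (Config n))) c f

theorem state_sum {ι : Type*} (s : Finset ι) (f : ι → 𝓢(Config n, ℂ)) :
    state (∑ i ∈ s, f i) = ∑ i ∈ s, state (f i) :=
  map_sum (SchwartzMap.toLpCLM ℂ ℂ 2 (volume : Measure (Config n))) f s

/-- Multiplying an ambiguity function by a coordinate gives ambiguity functions again, so that
ambiguity functions decay faster than every power. -/
theorem coord_mul_ambiguity {ħ : ℝ} (hħ : 0 < ħ) (a : Fin n ⊕ Fin n) (f g : 𝓢(Config n, ℂ))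
    (z : Phase n) :
    (z a : ℂ) * ambiguity ħ f g z =
      ambiguity ħ (canonical ħ a f) g z - ambiguity ħ f (canonical ħ a g) z := by
  simp only [ambiguity, weylHeisenberg_state]
  rw [inner_canonical_left, canonical_weylSchwartz hħ, state_add, state_smul, inner_add_right,
    inner_smul_right]
  ring

/-- Ambiguity functions decay in every coordinate at least like `(1 + z a ^ 2)⁻¹`, jointly. -/
theorem exists_prod_mul_norm_ambiguity_le {ħ : ℝ} (hħ : 0 < ħ) (s : Finset (Fin n ⊕ Fin n))
    (f g : 𝓢(Config n, ℂ)) :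
    ∃ C, ∀ z, (∏ a ∈ s, (1 + z a ^ 2)) * ‖ambiguity ħ f g z‖ ≤ C := by
  classical
  induction s using Finset.induction_on generalizing f g with
  | empty => exact ⟨_, fun z => by simpa using norm_ambiguity_le ħ f g z⟩
  | insert a s ha ih =>
    obtain ⟨C₀, h₀⟩ := ih f g
    obtain ⟨C₁, h₁⟩ := ih (canonical ħ a (canonical ħ a f)) g
    obtain ⟨C₂, h₂⟩ := ih (canonical ħ a f) (canonical ħ a g)
    obtain ⟨C₃, h₃⟩ := ih f (canonical ħ a (canonical ħ a g))
    refine ⟨C₀ + C₁ + 2 * C₂ + C₃, fun z => ?_⟩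
    have hp : 0 ≤ ∏ a ∈ s, (1 + z a ^ 2) := Finset.prod_nonneg fun a _ => by positivity
    have key : ((1 + z a ^ 2 : ℝ) : ℂ) * ambiguity ħ f g z = ambiguity ħ f g z +
        (ambiguity ħ (canonical ħ a (canonical ħ a f)) g z
          - 2 * ambiguity ħ (canonical ħ a f) (canonical ħ a g) z
          + ambiguity ħ f (canonical ħ a (canonical ħ a g)) z) := by
      have e1 := coord_mul_ambiguity hħ a f g z
      have e2 := coord_mul_ambiguity hħ a (canonical ħ a f) g z
      have e3 := coord_mul_ambiguity hħ a f (canonical ħ a g) z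
      push_cast
      linear_combination (z a : ℂ) * e1 + e2 - e3
    have hn : (1 + z a ^ 2) * ‖ambiguity ħ f g z‖ ≤ ‖ambiguity ħ f g z‖ +
        ‖ambiguity ħ (canonical ħ a (canonical ħ a f)) g z‖
          + 2 * ‖ambiguity ħ (canonical ħ a f) (canonical ħ a g) z‖
          + ‖ambiguity ħ f (canonical ħ a (canonical ħ a g)) z‖ := by
      have : (1 + z a ^ 2) * ‖ambiguity ħ f g z‖ =
          ‖((1 + z a ^ 2 : ℝ) : ℂ) * ambiguity ħ f g z‖ := by
        rw [norm_mul, Complex.norm_of_nonneg (by positivity)]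
      rw [this, key]
      refine (norm_add_le _ _).trans ?_
      have h4 := norm_add_le (ambiguity ħ (canonical ħ a (canonical ħ a f)) g z
          - 2 * ambiguity ħ (canonical ħ a f) (canonical ħ a g) z)
        (ambiguity ħ f (canonical ħ a (canonical ħ a g)) z)
      have h5 := norm_sub_le (ambiguity ħ (canonical ħ a (canonical ħ a f)) g z)
        (2 * ambiguity ħ (canonical ħ a f) (canonical ħ a g) z)
      rw [norm_mul, Complex.norm_ofNat] at h5
      linarith
    rw [Finset.prod_insert ha, mul_comm (1 + z a ^ 2), mul_assoc]
    refine (mul_le_mul_of_nonneg_left hn hp).trans ?_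
    have := h₀ z; have := h₁ z; have := h₂ z; have := h₃ z
    linarith

/-! ### Differentiability of the ambiguity function -/

/-- `w ↦ (i / ħ) Jw ⬝ c - (i / 2 ħ) σ(z, w) d`, the shape of the derivative of `T` at `z`. -/
def weylForm (ħ : ℝ) (z : Phase n) (c : Fin n ⊕ Fin n → ℂ) (d : ℂ) : Phase n →L[ℝ] ℂ :=
  (∑ a, (Complex.I / (ħ : ℂ) * c a) • (Complex.ofRealCLM ∘L
      (ContinuousLinearMap.proj a ∘L (Matrix.toLin' (J n)).toContinuousLinearMap)))
    - (Complex.I / (2 * (ħ : ℂ)) * d) • (Complex.ofRealCLM ∘L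
      ∑ a, (J n *ᵥ z) a • (ContinuousLinearMap.proj a : Phase n →L[ℝ] ℝ))

theorem weylForm_apply (ħ : ℝ) (z : Phase n) (c : Fin n ⊕ Fin n → ℂ) (d : ℂ) (w : Phase n) :
    weylForm ħ z c d w = Complex.I / (ħ : ℂ) * ∑ a, ((J n *ᵥ w) a : ℂ) * c a
      - Complex.I / (2 * (ħ : ℂ)) * (sympForm z w : ℂ) * d := by
  simp only [weylForm, sympForm, dotProduct, sub_apply,
    sum_apply, smul_apply, ContinuousLinearMap.comp_apply,
    ContinuousLinearMap.proj_apply, Complex.ofRealCLM_apply, LinearMap.coe_toContinuousLinearMap',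
    Matrix.toLin'_apply, smul_eq_mul, Finset.mul_sum]
  congr 1
  · exact Finset.sum_congr rfl fun a _ => by ring
  · ring

/-- A bound on `weylForm` that is uniform for `z` near `z₀`, for differentiation under the integral. -/
theorem exists_norm_weylForm_le (ħ : ℝ) (z₀ : Phase n) : ∃ K : ℝ, 0 ≤ K ∧
    ∀ z ∈ Metric.ball z₀ 1, ∀ c d, ‖weylForm ħ z c d‖ ≤ K * (∑ a, ‖c a‖ + ‖d‖) := by
  set A : Fin n ⊕ Fin n → (Phase n →L[ℝ] ℂ) := fun a => Complex.ofRealCLM ∘L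
      (ContinuousLinearMap.proj a ∘L (Matrix.toLin' (J n)).toContinuousLinearMap) with hA
  set B : Phase n → (Phase n →L[ℝ] ℂ) := fun z => Complex.ofRealCLM ∘L
      ∑ a, (J n *ᵥ z) a • (ContinuousLinearMap.proj a : Phase n →L[ℝ] ℝ) with hB
  have hBc : Continuous B := by
    refine continuous_const.clm_comp (continuous_finsetSum _ fun a _ => ?_)
    have : Continuous fun z : Phase n => (J n *ᵥ z) a :=
      (continuous_apply a).comp (Continuous.matrix_mulVec continuous_const continuous_id)
    exact this.smul continuous_const
  obtain ⟨K, hK⟩ := ((isCompact_closedBall z₀ 1).image hBc).isBounded.exists_norm_le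
  have hK0 : 0 ≤ K := (norm_nonneg _).trans
    (hK (B z₀) ⟨z₀, Metric.mem_closedBall_self zero_le_one, rfl⟩)
  refine ⟨‖Complex.I / (ħ : ℂ)‖ * ∑ a, ‖A a‖ + ‖Complex.I / (2 * (ħ : ℂ))‖ * K, by positivity,
    fun z hz c d => ?_⟩
  have h1 : ‖weylForm ħ z c d‖ ≤ (∑ a, ‖Complex.I / (ħ : ℂ)‖ * ‖c a‖ * ‖A a‖)
      + ‖Complex.I / (2 * (ħ : ℂ))‖ * ‖d‖ * ‖B z‖ := by
    refine (norm_sub_le _ _).trans (add_le_add ((norm_sum_le _ _).trans ?_) ?_)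
    · exact Finset.sum_le_sum fun a _ => by rw [norm_smul, norm_mul]
    · rw [norm_smul, norm_mul]
  have h2 : ‖B z‖ ≤ K := hK _ ⟨z, Metric.ball_subset_closedBall hz, rfl⟩
  have h3 : ∑ a, ‖Complex.I / (ħ : ℂ)‖ * ‖c a‖ * ‖A a‖ ≤
      ‖Complex.I / (ħ : ℂ)‖ * (∑ a, ‖A a‖) * ∑ a, ‖c a‖ := by
    rw [mul_assoc, Finset.mul_sum, Finset.mul_sum]
    refine Finset.sum_le_sum fun a _ => ?_
    rw [mul_assoc, mul_comm ‖c a‖]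
    gcongr
    exact Finset.single_le_sum (f := fun a => ‖A a‖) (fun a _ => norm_nonneg _) (Finset.mem_univ a)
  have h4 : ‖Complex.I / (2 * (ħ : ℂ))‖ * ‖d‖ * ‖B z‖ ≤ ‖Complex.I / (2 * (ħ : ℂ))‖ * K * ‖d‖ := by
    rw [mul_assoc, mul_assoc, mul_comm ‖d‖]
    gcongr
  have h5 : 0 ≤ ‖Complex.I / (ħ : ℂ)‖ * (∑ a, ‖A a‖) * ‖d‖ := by positivity
  have h6 : 0 ≤ ‖Complex.I / (2 * (ħ : ℂ))‖ * K * ∑ a, ‖c a‖ := by positivity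
  nlinarith

theorem fderiv_qPart (g : 𝓢(Config n, ℂ)) (x : Config n) (w : Phase n) :
    fderiv ℝ g x (qPart w) =
      ∑ j, (w (Sum.inl j) : ℂ) * fderiv ℝ g x (EuclideanSpace.single j (1 : ℝ)) := by
  have : qPart w = ∑ j, w (Sum.inl j) • EuclideanSpace.single j (1 : ℝ) := by
    ext i
    simp [qPart, Pi.single_apply]
  rw [this, map_sum]
  exact Finset.sum_congr rfl fun j _ => by rw [map_smul, Complex.real_smul]

theorem hasFDerivAt_weylFun {ħ : ℝ} (hħ : 0 < ħ) (g : 𝓢(Config n, ℂ)) (x : Config n)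
    (z : Phase n) :
    HasFDerivAt (fun z => weylFun ħ z g x)
      (weylForm ħ z (fun a => weylFun ħ z (canonical ħ a g) x) (weylFun ħ z g x)) z := by
  have hħ' : (ħ : ℂ) ≠ 0 := by exact_mod_cast hħ.ne'
  have hproj : ∀ a, HasFDerivAt (fun z : Phase n => z a)
      (ContinuousLinearMap.proj a : Phase n →L[ℝ] ℝ) z := fun a => hasFDerivAt_apply a z
  have h1 : HasFDerivAt (fun z : Phase n =>
      ∑ j, z (Sum.inr j) * x j - (∑ j, z (Sum.inr j) * z (Sum.inl j)) / 2)
      ((∑ j, x j • (ContinuousLinearMap.proj (Sum.inr j) : Phase n →L[ℝ] ℝ)) -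
        (2 : ℝ)⁻¹ • ∑ j, (z (Sum.inr j) • (ContinuousLinearMap.proj (Sum.inl j) : Phase n →L[ℝ] ℝ)
          + z (Sum.inl j) • (ContinuousLinearMap.proj (Sum.inr j) : Phase n →L[ℝ] ℝ))) z := by
    refine HasFDerivAt.sub (HasFDerivAt.fun_sum fun j _ => (hproj _).mul_const _) ?_
    simp only [div_eq_mul_inv]
    exact (HasFDerivAt.fun_sum fun j _ => (hproj _).mul (hproj _)).mul_const _
  have h2 := ((Complex.ofRealCLM.hasFDerivAt.comp z h1).const_mul (Complex.I / (ħ : ℂ))).cexp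
  let q : Phase n →L[ℝ] Config n := LinearMap.toContinuousLinearMap
    { toFun := qPart, map_add' := fun _ _ => rfl, map_smul' := fun _ _ => rfl }
  have h3 : HasFDerivAt (fun z : Phase n => g (x - qPart z))
      (fderiv ℝ g (x - qPart z) ∘L (-q)) z := by
    have h4 : HasFDerivAt (fun z : Phase n => x - qPart z) (-q) z := q.hasFDerivAt.const_sub x
    exact (g.hasFDerivAt (x - qPart z)).comp z h4
  refine (h2.fun_mul h3).congr_fderiv ?_
  ext w
  have hqw : q w = qPart w := rfl
  rw [weylForm_apply, sympForm_eq_sum, Fintype.sum_sum_type]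
  simp only [J_mulVec_inl, J_mulVec_inr, weylFun_eq, canonical, position_apply, momentum_apply,
    add_apply, smul_apply, ContinuousLinearMap.comp_apply,
    neg_apply, sub_apply, sum_apply,
    ContinuousLinearMap.proj_apply, Complex.ofRealCLM_apply, smul_eq_mul, map_neg, hqw,
    fderiv_qPart, Function.comp]
  change weylFactor ħ z x * _ + _ * (weylFactor ħ z x * _) = _
  generalize weylFactor ħ z x = e
  generalize g (x - qPart z) = y
  have hq : ∀ j, ((x - qPart z) j : ℝ) = x j - z (Sum.inl j) := fun j => rfl
  simp only [hq]
  push_cast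
  simp only [Finset.mul_sum, Finset.sum_mul, ← Finset.sum_add_distrib, ← Finset.sum_sub_distrib,
    ← Finset.sum_neg_distrib]
  refine Finset.sum_congr rfl fun j _ => ?_
  field_simp
  ring_nf
  simp only [Complex.I_sq]
  ring

/-- Differentiation under the integral. The functions `T(z) C g`, `C` a canonical operator, are bounded
uniformly in `z`, so that multiples of `|f|` dominate the derivative of the integrand. -/
theorem hasFDerivAt_ambiguity {ħ : ℝ} (hħ : 0 < ħ) (f g : 𝓢(Config n, ℂ)) (z₀ : Phase n) :
    HasFDerivAt (ambiguity ħ f g)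
      (weylForm ħ z₀ (fun a => ambiguity ħ f (canonical ħ a g) z₀) (ambiguity ħ f g z₀)) z₀ := by
  obtain ⟨K, hK0, hK⟩ := exists_norm_weylForm_le ħ z₀
  have hbd : ∀ g : 𝓢(Config n, ℂ), ∃ C, 0 ≤ C ∧ ∀ x, ‖g x‖ ≤ C := fun g =>
    ⟨_, apply_nonneg _ _, SchwartzMap.norm_le_seminorm ℝ g⟩
  choose C hC0 hC using hbd
  have hmeas : ∀ (z : Phase n) (g : 𝓢(Config n, ℂ)), AEStronglyMeasurable
      (fun x => (starRingEnd ℂ) (f x) * weylFun ħ z g x) volume := fun z g =>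
    ((Complex.continuous_conj.comp f.continuous).aestronglyMeasurable).mul
      (aestronglyMeasurable_weylFun ħ z g.continuous.aestronglyMeasurable)
  have hint : ∀ (z : Phase n) (g : 𝓢(Config n, ℂ)), Integrable
      (fun x => (starRingEnd ℂ) (f x) * weylFun ħ z g x) volume := fun z g => by
    refine (f.integrable (μ := volume).norm.mul_const (C g)).mono' (hmeas z g) ?_
    refine Filter.Eventually.of_forall fun x => ?_
    rw [norm_mul, RCLike.norm_conj, norm_weylFun]
    exact mul_le_mul_of_nonneg_left (hC g _) (norm_nonneg _)
  set D : Phase n → Config n → (Phase n →L[ℝ] ℂ) := fun z x =>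
    weylForm ħ z (fun a => (starRingEnd ℂ) (f x) * weylFun ħ z (canonical ħ a g) x)
      ((starRingEnd ℂ) (f x) * weylFun ħ z g x) with hD
  have hDmeas : AEStronglyMeasurable (D z₀) volume := by
    refine AEStronglyMeasurable.sub ?_ ?_
    · refine Finset.aestronglyMeasurable_fun_sum _ fun a _ => ?_
      exact (((hmeas z₀ _).const_mul _).smul_const _)
    · exact ((hmeas z₀ _).const_mul _).smul_const _
  have hDbound : ∀ z ∈ Metric.ball z₀ 1, ∀ x,
      ‖D z x‖ ≤ ‖f x‖ * (K * (∑ a, C (canonical ħ a g) + C g)) := by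
    intro z hz x
    refine (hK z hz _ _).trans ?_
    simp only [norm_mul, RCLike.norm_conj, norm_weylFun, ← Finset.mul_sum, ← mul_add]
    rw [mul_left_comm]
    gcongr
    · exact hC _ _
    · exact hC _ _
  have hmain := hasFDerivAt_integral_of_dominated_of_fderiv_le (μ := volume) (𝕜 := ℝ)
    (F := fun z x => (starRingEnd ℂ) (f x) * weylFun ħ z g x) (F' := D)
    (Metric.ball_mem_nhds z₀ one_pos) (Filter.Eventually.of_forall fun z => hmeas z g)
    (hint z₀ g) hDmeas (Filter.Eventually.of_forall fun x z hz => hDbound z hz x)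
    (f.integrable.norm.mul_const _) (Filter.Eventually.of_forall fun x z _ => by
      refine ((hasFDerivAt_weylFun hħ g x z).const_mul _).congr_fderiv ?_
      ext w
      simp only [hD, weylForm_apply, smul_apply, smul_eq_mul, mul_sub,
        Finset.mul_sum]
      congr 1
      · exact Finset.sum_congr rfl fun a _ => by ring
      · ring)
  have hfun : ambiguity ħ f g = fun z => ∫ x, (starRingEnd ℂ) (f x) * weylFun ħ z g x :=
    funext fun z => ambiguity_eq_integral ħ f g z
  have hDint : Integrable (D z₀) volume :=
    (f.integrable (μ := volume).norm.mul_const _).mono' hDmeas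
      (Filter.Eventually.of_forall fun x => hDbound z₀ (Metric.mem_ball_self one_pos) x)
  rw [hfun]
  refine hmain.congr_fderiv ?_
  ext w
  rw [ContinuousLinearMap.integral_apply hDint]
  simp only [hD, weylForm_apply, ambiguity_eq_integral]
  rw [integral_sub, integral_const_mul, integral_finsetSum, integral_const_mul]
  · simp only [integral_const_mul]
  · exact fun a _ => (hint z₀ _).const_mul _
  · exact (integrable_finsetSum _ fun a _ => (hint z₀ _).const_mul _).const_mul _
  · exact (hint z₀ _).const_mul _

theorem continuous_ambiguity {ħ : ℝ} (hħ : 0 < ħ) (f g : 𝓢(Config n, ℂ)) :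
    Continuous (ambiguity ħ f g) :=
  continuous_iff_continuousAt.2 fun z => (hasFDerivAt_ambiguity hħ f g z).continuousAt

theorem integrable_ambiguity {ħ : ℝ} (hħ : 0 < ħ) (f g : 𝓢(Config n, ℂ)) :
    Integrable (ambiguity ħ f g) volume := by
  obtain ⟨C, hC⟩ := exists_prod_mul_norm_ambiguity_le hħ Finset.univ f g
  have h1 : Integrable (fun z : Phase n => ∏ a, (1 + z a ^ 2)⁻¹) volume :=
    Integrable.fintype_prod (f := fun _ (t : ℝ) => (1 + t ^ 2)⁻¹)
      fun _ => integrable_inv_one_add_sq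
  refine (h1.const_mul C).mono' (continuous_ambiguity hħ f g).aestronglyMeasurable
    (Filter.Eventually.of_forall fun z => ?_)
  have hp : 0 < ∏ a, (1 + z a ^ 2) := Finset.prod_pos fun a _ => by positivity
  rw [Finset.prod_inv_distrib, ← div_eq_mul_inv, le_div_iff₀ hp, mul_comm]
  exact hC z

/-! ### Strong continuity -/

theorem dense_range_state : DenseRange (state : 𝓢(Config n, ℂ) → QState n) :=
  SchwartzMap.denseRange_toLpCLM (F := ℂ) (p := 2) (μ := (volume : Measure (Config n))) (by simp)

theorem continuous_weylHeisenberg_state {ħ : ℝ} (hħ : 0 < ħ) (g : 𝓢(Config n, ℂ)) :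
    Continuous fun z => weylHeisenberg ħ z (state g) := by
  refine continuous_iff_continuousAt.2 fun z₀ => ?_
  rw [ContinuousAt, tendsto_iff_norm_sub_tendsto_zero]
  -- `T` is isometric, so that strong continuity follows from weak continuity.
  have h1 : ∀ z, ‖weylHeisenberg ħ z (state g) - weylHeisenberg ħ z₀ (state g)‖ =
      √(2 * ‖state g‖ ^ 2 - 2 * (ambiguity ħ (weylSchwartz ħ z₀ g) g z).re) := by
    intro z
    rw [← Real.sqrt_sq (norm_nonneg (_ - _)), @norm_sub_sq ℂ, LinearIsometry.norm_map,
      LinearIsometry.norm_map, ← inner_conj_symm, ambiguity, ← weylHeisenberg_state,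
      RCLike.conj_re]
    congr 1
    simp only [RCLike.re_to_complex]
    ring
  have h2 : Continuous fun z => √(2 * ‖state g‖ ^ 2
      - 2 * (ambiguity ħ (weylSchwartz ħ z₀ g) g z).re) := by
    have := continuous_ambiguity hħ (weylSchwartz ħ z₀ g) g
    fun_prop
  have h3 := h2.tendsto z₀
  simp only [h1]
  rwa [← h1, sub_self, norm_zero] at h3

theorem continuous_weylHeisenberg {ħ : ℝ} (hħ : 0 < ħ) (f : QState n) :
    Continuous fun z => weylHeisenberg ħ z f := by
  refine dense_range_state.induction_on (p := fun f : QState n =>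
    Continuous fun z => weylHeisenberg ħ z f) f ?_ fun g => continuous_weylHeisenberg_state hħ g
  rw [← isSeqClosed_iff_isClosed]
  intro u f hu hf
  refine TendstoUniformly.continuous (F := fun k z => weylHeisenberg ħ z (u k))
    (p := Filter.atTop) ?_ (Filter.Frequently.of_forall hu)
  rw [Metric.tendstoUniformly_iff]
  intro ε hε
  filter_upwards [(Metric.tendsto_nhds.1 hf) ε hε] with k hk z
  rwa [LinearIsometry.dist_map, dist_comm]

/-! ### Quadratic Hamiltonians and translations -/

theorem inner_quadraticHamiltonian_left (ħ : ℝ) {S : PhaseMatrix n} (hS : S.IsSymm)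
    (f g : 𝓢(Config n, ℂ)) :
    inner ℂ (state (quadraticHamiltonian ħ S f)) (state g) =
      inner ℂ (state f) (state (quadraticHamiltonian ħ S g)) := by
  simp only [quadraticHamiltonian, state_smul, state_sum, inner_smul_left, inner_smul_right,
    sum_inner, inner_sum, inner_canonical_left, Complex.conj_ofReal]
  rw [Finset.sum_comm]
  simp only [hS.apply, one_div, map_inv₀, Complex.conj_ofNat]

/-- `T(z)⁻¹ H T(z) = H + z ⬝ S Z + ½ z ⬝ S z` for `H = ½ Z ⬝ S Z`. -/
theorem quadraticHamiltonian_weylSchwartz {ħ : ℝ} (hħ : 0 < ħ) {S : PhaseMatrix n}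
    (hS : S.IsSymm) (z : Phase n) (g : 𝓢(Config n, ℂ)) :
    quadraticHamiltonian ħ S (weylSchwartz ħ z g) =
      weylSchwartz ħ z (quadraticHamiltonian ħ S g)
        + ∑ a, ((S *ᵥ z) a : ℂ) • weylSchwartz ħ z (canonical ħ a g)
        + ((z ⬝ᵥ (S *ᵥ z) / 2 : ℝ) : ℂ) • weylSchwartz ħ z g := by
  have h1 : ∑ a, ∑ b, ((S a b : ℝ) : ℂ) • (z a : ℂ) • weylSchwartz ħ z (canonical ħ b g) =
      ∑ a, ((S *ᵥ z) a : ℂ) • weylSchwartz ħ z (canonical ħ a g) := by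
    rw [Finset.sum_comm]
    refine Finset.sum_congr rfl fun b _ => ?_
    simp only [smul_smul, ← Finset.sum_smul, Matrix.mulVec, dotProduct]
    push_cast
    simp only [hS.apply b]
  have h2 : ∑ a, ∑ b, ((S a b : ℝ) : ℂ) • (z b : ℂ) • weylSchwartz ħ z (canonical ħ a g) =
      ∑ a, ((S *ᵥ z) a : ℂ) • weylSchwartz ħ z (canonical ħ a g) := by
    refine Finset.sum_congr rfl fun b _ => ?_
    simp only [smul_smul, ← Finset.sum_smul, Matrix.mulVec, dotProduct]
    push_cast
    rfl
  have h3 : ∑ a, ∑ b, ((S a b : ℝ) : ℂ) • (z b : ℂ) • (z a : ℂ) • weylSchwartz ħ z g =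
      ((z ⬝ᵥ (S *ᵥ z) : ℝ) : ℂ) • weylSchwartz ħ z g := by
    simp only [smul_smul, ← Finset.sum_smul, Matrix.mulVec, dotProduct]
    push_cast
    simp only [Finset.mul_sum]
    congr 1
    exact Finset.sum_congr rfl fun a _ => Finset.sum_congr rfl fun b _ => by ring
  simp only [quadraticHamiltonian, canonical_weylSchwartz hħ, map_add, map_smul, map_sum, smul_add,
    Finset.sum_add_distrib, h1, h2, h3]
  push_cast
  module

theorem J_mul_J : J n * J n = -1 := by
  simp [J, Matrix.fromBlocks_multiply, ← Matrix.fromBlocks_one, Matrix.fromBlocks_neg]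

theorem J_transpose : (J n)ᵀ = -J n := by
  simp [J, Matrix.fromBlocks_transpose, Matrix.fromBlocks_neg]

theorem sympForm_J_mulVec (z w : Phase n) : sympForm z (J n *ᵥ w) = z ⬝ᵥ w := by
  rw [sympForm_eq_sum]
  simp only [J_mulVec_inl, J_mulVec_inr, dotProduct, Fintype.sum_sum_type,
    ← Finset.sum_add_distrib]
  exact Finset.sum_congr rfl fun j _ => by ring

/-- If `z` moves with the velocity `JSz` of the linear Hamiltonian flow, then the derivative of
`⟨f, T(z) g⟩` is given by the commutator of the quadratic Hamiltonian with `T(z)`. -/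
theorem weylForm_flow {ħ : ℝ} (hħ : 0 < ħ) {S : PhaseMatrix n} (hS : S.IsSymm)
    (f g : 𝓢(Config n, ℂ)) (z : Phase n) :
    weylForm ħ z (fun a => ambiguity ħ f (canonical ħ a g) z) (ambiguity ħ f g z)
        (J n *ᵥ (S *ᵥ z)) =
      (-Complex.I / (ħ : ℂ)) * (ambiguity ħ (quadraticHamiltonian ħ S f) g z
        - ambiguity ħ f (quadraticHamiltonian ħ S g) z) := by
  rw [weylForm_apply, sympForm_J_mulVec, Matrix.mulVec_mulVec, J_mul_J]
  simp only [ambiguity, weylHeisenberg_state]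
  rw [inner_quadraticHamiltonian_left ħ hS, quadraticHamiltonian_weylSchwartz hħ hS]
  simp only [state_add, state_smul, state_sum, inner_add_right, inner_sum, inner_smul_right,
    Matrix.neg_mulVec, Matrix.one_mulVec, Pi.neg_apply, Complex.ofReal_neg, neg_mul,
    Finset.sum_neg_distrib]
  push_cast
  ring

/-! ### Differentiating matrix elements along a curve -/

section Inner

variable {E : Type*} [NormedAddCommGroup E] [InnerProductSpace ℂ E]

/-- In a product, the factor that does not vanish at the point only has to be continuous. -/
theorem hasDerivWithinAt_inner_right_of_eq_zero {u v : ℝ → E} {u' : E} {s : Set ℝ} {t : ℝ}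
    (hu : HasDerivWithinAt u u' s t) (hv : ContinuousWithinAt v s t) (h0 : u t = 0) :
    HasDerivWithinAt (fun r => inner ℂ (v r) (u r)) (inner ℂ (v t) u') s t := by
  rw [hasDerivWithinAt_iff_tendsto_slope] at hu ⊢
  have hv' : Filter.Tendsto v (nhdsWithin t (s \ {t})) (nhds (v t)) :=
    hv.tendsto.mono_left (nhdsWithin_mono _ Set.sdiff_subset)
  refine (hv'.inner (𝕜 := ℂ) hu).congr fun r => ?_
  simp only [slope, vsub_eq_sub, h0, sub_zero, inner_zero_right]
  rw [← Complex.coe_smul, inner_smul_right, Complex.real_smul]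

theorem hasDerivWithinAt_inner_left_of_eq_zero {u v : ℝ → E} {u' : E} {s : Set ℝ} {t : ℝ}
    (hu : HasDerivWithinAt u u' s t) (hv : ContinuousWithinAt v s t) (h0 : u t = 0) :
    HasDerivWithinAt (fun r => inner ℂ (u r) (v r)) (inner ℂ u' (v t)) s t := by
  have h := (hasDerivWithinAt_inner_right_of_eq_zero hu hv h0)
  have h2 := (Complex.conjCLE : ℂ →L[ℝ] ℂ).hasFDerivAt.comp_hasDerivWithinAt t h
  simpa [Function.comp_def] using h2

end Inner

/-- The product rule for `⟨h(r), T(z(r)) g(r)⟩`. Since `T` is differentiable only weakly, and only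
on Schwartz functions, the values `h(t)` and `g(t)` at the point in question have to be Schwartz
functions. -/
theorem hasDerivWithinAt_inner_weylHeisenberg {ħ : ℝ} (hħ : 0 < ħ) {h g : ℝ → QState n}
    {z : ℝ → Phase n} {h' g' : QState n} {z' : Phase n} {s : Set ℝ} {t : ℝ}
    {φ ψ : 𝓢(Config n, ℂ)} (hφ : h t = state φ) (hψ : g t = state ψ)
    (hh : HasDerivWithinAt h h' s t) (hg : HasDerivWithinAt g g' s t)
    (hz : HasDerivWithinAt z z' s t) :
    HasDerivWithinAt (fun r => inner ℂ (h r) (weylHeisenberg ħ (z r) (g r)))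
      (inner ℂ h' (weylHeisenberg ħ (z t) (g t)) + inner ℂ (h t) (weylHeisenberg ħ (z t) g')
        + weylForm ħ (z t) (fun a => ambiguity ħ φ (canonical ħ a ψ) (z t))
          (ambiguity ħ φ ψ (z t)) z') s t := by
  have hT : ∀ (k : ℝ → Phase n) (f : QState n), ContinuousWithinAt k s t →
      ContinuousWithinAt (fun r => weylHeisenberg ħ (k r) f) s t := fun k f hk =>
    (continuous_weylHeisenberg hħ f).continuousAt.comp_continuousWithinAt hk
  have hTg : ContinuousWithinAt (fun r => weylHeisenberg ħ (z r) (g r)) s t := by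
    have h1 := hT z (g t) hz.continuousWithinAt
    rw [ContinuousWithinAt, tendsto_iff_norm_sub_tendsto_zero] at h1 ⊢
    have h2 := hg.continuousWithinAt
    rw [ContinuousWithinAt, tendsto_iff_norm_sub_tendsto_zero] at h2
    refine squeeze_zero (fun _ => norm_nonneg _) (fun r => ?_) (by simpa using h2.add h1)
    calc ‖weylHeisenberg ħ (z r) (g r) - weylHeisenberg ħ (z t) (g t)‖
        = ‖weylHeisenberg ħ (z r) (g r - g t)
            + (weylHeisenberg ħ (z r) (g t) - weylHeisenberg ħ (z t) (g t))‖ := by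
          rw [map_sub]; congr 1; abel
      _ ≤ _ := (norm_add_le _ _).trans (by rw [LinearIsometry.norm_map])
  -- The matrix element is the sum of `⟨h(r) - h(t), T(z(r)) g(r)⟩`, `⟨h(t), T(z(r)) (g(r) - g(t))⟩`
  -- and `⟨h(t), T(z(r)) g(t)⟩`; the last term is an ambiguity function along the curve `z`.
  have e1 := hasDerivWithinAt_inner_left_of_eq_zero (hh.sub_const (h t)) hTg (sub_self _)
  have e2 := hasDerivWithinAt_inner_right_of_eq_zero (hg.sub_const (g t))
    (hT (fun r => -z r) (h t) hz.continuousWithinAt.neg) (sub_self _)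
  have e3 := (hasFDerivAt_ambiguity hħ φ ψ (z t)).comp_hasDerivWithinAt t hz
  have e4 : inner ℂ (weylHeisenberg ħ (-z t) (h t)) g' =
      inner ℂ (h t) (weylHeisenberg ħ (z t) g') := by
    rw [inner_weylHeisenberg_left, neg_neg]
  rw [← e4]
  have e5 : (fun r => inner ℂ (h r) (weylHeisenberg ħ (z r) (g r))) = fun r =>
      inner ℂ (h r - h t) (weylHeisenberg ħ (z r) (g r))
        + inner ℂ (weylHeisenberg ħ (-z r) (h t)) (g r - g t) + ambiguity ħ φ ψ (z r) := by
    funext r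
    rw [inner_weylHeisenberg_left, neg_neg, map_sub, inner_sub_left, inner_sub_right, ambiguity,
      ← hφ, ← hψ]
    ring
  rw [e5]
  exact (e1.fun_add e2).fun_add e3

/-! ### Covariance -/

theorem transpose_mul_J_mul {F : PhaseMatrix n} (hF : F ∈ Matrix.symplecticGroup (Fin n) ℝ) :
    Fᵀ * J n * F = J n := by
  have h := SymplecticGroup.mem_iff'.1 hF
  have hJ : J n = -Matrix.J (Fin n) ℝ := by simp [J, Matrix.J, Matrix.fromBlocks_neg]
  rw [hJ, mul_neg, neg_mul, h]

theorem IsSymplecticPath.deriv_relation {M : PhaseMatrix n} {F F' : ℝ → PhaseMatrix n}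
    (hF : IsSymplecticPath M F F') {t : ℝ} (ht : t ∈ Set.Icc (0 : ℝ) 1) :
    (F' t)ᵀ * J n * F t + (F t)ᵀ * J n * F' t = 0 := by
  ext a b
  have h1 : HasDerivWithinAt (fun s => ((F s)ᵀ * J n * F s) a b)
      (((F' t)ᵀ * J n * F t + (F t)ᵀ * J n * F' t) a b) (Set.Icc 0 1) t := by
    simp only [Matrix.mul_apply, Matrix.add_apply, Matrix.transpose_apply,
      ← Finset.sum_add_distrib]
    refine HasDerivWithinAt.fun_sum fun c _ => ?_
    refine HasDerivWithinAt.fun_mul (HasDerivWithinAt.fun_sum fun d _ => ?_) (hF.hasDeriv t ht c b)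
    exact (hF.hasDeriv t ht d a).mul_const _
  have h2 : HasDerivWithinAt (fun s => ((F s)ᵀ * J n * F s) a b) 0 (Set.Icc 0 1) t := by
    refine (hasDerivWithinAt_const t (Set.Icc (0 : ℝ) 1) (J n a b)).congr (fun s hs => ?_) ?_
    · rw [transpose_mul_J_mul (hF.symplectic s hs)]
    · rw [transpose_mul_J_mul (hF.symplectic t ht)]
  exact (uniqueDiffOn_Icc_zero_one t ht).eq_deriv _ h1 h2

theorem IsSymplecticPath.isUnit_det {M : PhaseMatrix n} {F F' : ℝ → PhaseMatrix n}
    (hF : IsSymplecticPath M F F') {t : ℝ} (ht : t ∈ Set.Icc (0 : ℝ) 1) : IsUnit (F t).det :=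
  SymplecticGroup.symplectic_det (hF.symplectic t ht)

/-- The Hamiltonian `S = -J F' F⁻¹` of a path of symplectic matrices is a symmetric matrix. -/
theorem IsSymplecticPath.isSymm {M : PhaseMatrix n} {F F' : ℝ → PhaseMatrix n}
    (hF : IsSymplecticPath M F F') {t : ℝ} (ht : t ∈ Set.Icc (0 : ℝ) 1) :
    (-(J n * F' t * (F t)⁻¹)).IsSymm := by
  have h1 := hF.deriv_relation ht
  have h2 : F t * (F t)⁻¹ = 1 := Matrix.mul_nonsing_inv _ (hF.isUnit_det ht)
  have h3 : ((F t)⁻¹)ᵀ * (F t)ᵀ = 1 := by rw [← Matrix.transpose_mul, h2, Matrix.transpose_one]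
  have h4 : ((F t)⁻¹)ᵀ * ((F' t)ᵀ * J n * F t + (F t)ᵀ * J n * F' t) * (F t)⁻¹ =
      ((F t)⁻¹)ᵀ * (F' t)ᵀ * J n + J n * F' t * (F t)⁻¹ := by
    calc _ = ((F t)⁻¹)ᵀ * (F' t)ᵀ * J n * (F t * (F t)⁻¹)
          + (((F t)⁻¹)ᵀ * (F t)ᵀ) * J n * F' t * (F t)⁻¹ := by noncomm_ring
      _ = _ := by rw [h2, h3]; simp
  rw [h1] at h4
  rw [Matrix.IsSymm, Matrix.transpose_neg, Matrix.transpose_mul, Matrix.transpose_mul, J_transpose]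
  simp only [mul_neg, neg_neg, mul_zero, zero_mul] at h4 ⊢
  rw [← mul_assoc]
  exact eq_neg_of_add_eq_zero_left h4.symm

theorem IsSymplecticPath.hasDerivWithinAt_mulVec {M : PhaseMatrix n} {F F' : ℝ → PhaseMatrix n}
    (hF : IsSymplecticPath M F F') {t : ℝ} (ht : t ∈ Set.Icc (0 : ℝ) 1) (z : Phase n) :
    HasDerivWithinAt (fun s => F s *ᵥ z)
      (J n *ᵥ ((-(J n * F' t * (F t)⁻¹)) *ᵥ (F t *ᵥ z))) (Set.Icc 0 1) t := by
  have h1 : J n * (-(J n * F' t * (F t)⁻¹)) * F t = F' t := by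
    calc _ = -((J n * J n) * F' t * ((F t)⁻¹ * F t)) := by noncomm_ring
      _ = _ := by rw [J_mul_J, Matrix.nonsing_inv_mul _ (hF.isUnit_det ht)]; simp
  rw [Matrix.mulVec_mulVec, Matrix.mulVec_mulVec, h1]
  rw [hasDerivWithinAt_pi]
  intro a
  simp only [Matrix.mulVec, dotProduct]
  exact HasDerivWithinAt.fun_sum fun b _ => (hF.hasDeriv t ht a b).mul_const _

/-- Covariance of the propagator: the matrix element `⟨U(t) h, T(F(t) z) U(t) f⟩` is a constant of
the motion. -/
theorem IsPropagator.inner_weylHeisenberg {ħ : ℝ} (hħ : 0 < ħ) {M : PhaseMatrix n}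
    {F F' : ℝ → PhaseMatrix n} {U : ℝ → (QState n ≃ₗᵢ[ℂ] QState n)}
    (hF : IsSymplecticPath M F F') (hU : IsPropagator ħ (fun t => -(J n * F' t * (F t)⁻¹)) U)
    (z : Phase n) (h f : 𝓢(Config n, ℂ)) {t : ℝ} (ht : t ∈ Set.Icc (0 : ℝ) 1) :
    inner ℂ (U t (state h)) (weylHeisenberg ħ (F t *ᵥ z) (U t (state f))) =
      inner ℂ (state h) (weylHeisenberg ħ z (state f)) := by
  set a : ℝ → ℂ := fun s =>
    inner ℂ (U s (state h)) (weylHeisenberg ħ (F s *ᵥ z) (U s (state f))) with ha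
  have hder : ∀ s ∈ Set.Icc (0 : ℝ) 1, HasDerivWithinAt a 0 (Set.Icc 0 1) s := by
    intro s hs
    obtain ⟨φ, hφ, hφ'⟩ := hU.schrodinger s hs h
    obtain ⟨ψ, hψ, hψ'⟩ := hU.schrodinger s hs f
    refine (hasDerivWithinAt_inner_weylHeisenberg hħ hφ hψ hφ' hψ'
      (hF.hasDerivWithinAt_mulVec hs z)).congr_deriv ?_
    rw [weylForm_flow hħ (hF.isSymm hs), hφ, hψ, map_smul, inner_smul_left, inner_smul_right]
    simp only [ambiguity, map_div₀, map_neg, Complex.conj_I, Complex.conj_ofReal]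
    ring
  have hconst := constant_of_has_deriv_right_zero
    (fun s hs => (hder s hs).continuousWithinAt) (fun s hs =>
      (hder s ⟨hs.1, hs.2.le⟩).mono_of_mem_nhdsWithin (Icc_mem_nhdsGE_of_mem hs)) t ht
  have h0 : a 0 = inner ℂ (state h) (weylHeisenberg ħ z (state f)) := by
    simp only [ha, hU.initial, hF.source, Matrix.one_mulVec]
  rw [← h0, ← hconst]

theorem IsMetaplecticOperator.map_state {ħ : ℝ} {M : PhaseMatrix n}
    {R : QState n ≃ₗᵢ[ℂ] QState n} (hR : IsMetaplecticOperator ħ M R) (f : 𝓢(Config n, ℂ)) :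
    ∃ g : 𝓢(Config n, ℂ), R (state f) = state g := by
  obtain ⟨F, F', U, -, hU, rfl⟩ := hR
  obtain ⟨g, hg, -⟩ := hU.schrodinger 1 (by simp) f
  exact ⟨g, hg⟩

/-- Covariance of metaplectic operators: `R T(z) = T(M z) R`. -/
theorem IsMetaplecticOperator.map_weylHeisenberg {ħ : ℝ} (hħ : 0 < ħ) {M : PhaseMatrix n}
    {R : QState n ≃ₗᵢ[ℂ] QState n} (hR : IsMetaplecticOperator ħ M R) (z : Phase n)
    (f : QState n) :
    R (weylHeisenberg ħ z f) = weylHeisenberg ħ (M *ᵥ z) (R f) := by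
  obtain ⟨F, F', U, hF, hU, rfl⟩ := hR
  have h1 : (1 : ℝ) ∈ Set.Icc (0 : ℝ) 1 := by simp
  refine dense_range_state.induction_on (p := fun f : QState n =>
    U 1 (weylHeisenberg ħ z f) = weylHeisenberg ħ (M *ᵥ z) (U 1 f)) f ?_ fun f => ?_
  · exact isClosed_eq ((U 1).continuous.comp (weylHeisenberg ħ z).continuous)
      ((weylHeisenberg ħ _).continuous.comp (U 1).continuous)
  · have hd : Dense (Set.range fun h : 𝓢(Config n, ℂ) => U 1 (state h)) :=
      (U 1).surjective.denseRange.comp dense_range_state (U 1).continuous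
    refine hd.eq_of_inner_right (𝕜 := ℂ) ?_
    rintro _ ⟨h, rfl⟩
    rw [LinearIsometryEquiv.inner_map_map, ← IsPropagator.inner_weylHeisenberg hħ hF hU z h f h1,
      hF.target]

/-! ### Orthogonality relations of the Weyl-Heisenberg operators -/

/-- `(q, p) ↦ z`, as a measurable equivalence. -/
def prodEquivPhase (n : ℕ) : Config n × Config n ≃ᵐ Phase n :=
  ((MeasurableEquiv.toLp 2 (Fin n → ℝ)).symm.prodCongr
    (MeasurableEquiv.toLp 2 (Fin n → ℝ)).symm).trans
    (MeasurableEquiv.sumPiEquivProdPi (fun _ => ℝ)).symm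

theorem measurePreserving_prodEquivPhase (n : ℕ) :
    MeasurePreserving (prodEquivPhase n) (volume.prod volume) volume :=
  ((EuclideanSpace.volume_preserving_symm_measurableEquiv_toLp _).prod
    (EuclideanSpace.volume_preserving_symm_measurableEquiv_toLp _)).trans
    (volume_measurePreserving_sumPiEquivProdPi_symm _)

theorem qPart_prodEquivPhase (x : Config n × Config n) : qPart (prodEquivPhase n x) = x.1 := rfl

theorem pPart_prodEquivPhase (x : Config n × Config n) : pPart (prodEquivPhase n x) = x.2 := rfl

/-- The product `x ↦ conj (f x) g (x - q)` of Schwartz functions. -/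
def shiftProd (f g : 𝓢(Config n, ℂ)) (q : Config n) : 𝓢(Config n, ℂ) :=
  SchwartzMap.bilinLeftCLM (ContinuousLinearMap.mul ℝ ℂ)
    (Complex.conjCLE.toContinuousLinearMap.hasTemperateGrowth.comp f.hasTemperateGrowth)
    (SchwartzMap.compSubConstCLM ℝ q g)

theorem shiftProd_apply (f g : 𝓢(Config n, ℂ)) (q x : Config n) :
    shiftProd f g q x = (starRingEnd ℂ) (f x) * g (x - q) := by
  simp [shiftProd, mul_comm]

/-- For fixed `q` the ambiguity function is a Fourier transform in `p`. -/
theorem ambiguity_prodEquivPhase {ħ : ℝ} (hħ : 0 < ħ) (f g : 𝓢(Config n, ℂ))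
    (q p : Config n) :
    ambiguity ħ f g (prodEquivPhase n (q, p)) =
      phase ħ (-∑ j, p j * q j) *
        FourierTransform.fourier (shiftProd f g q) ((-(2 * Real.pi * ħ)⁻¹ : ℝ) • p) := by
  rw [SchwartzMap.fourier_coe, Real.fourier_eq', ← integral_const_mul, ambiguity_eq_integral]
  refine integral_congr_ae (Filter.Eventually.of_forall fun x => ?_)
  simp only [weylFun_eq, weylFactor, qPart_prodEquivPhase, pPart_prodEquivPhase, shiftProd_apply,
    smul_eq_mul, phase]
  rw [mul_left_comm (Complex.exp _) ((starRingEnd ℂ) (f x)),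
    mul_left_comm (Complex.exp _) ((starRingEnd ℂ) (f x)),
    ← mul_assoc (Complex.exp _) (Complex.exp _), ← Complex.exp_add]
  congr 3
  have h1 : inner ℝ x ((-(2 * Real.pi * ħ)⁻¹ : ℝ) • p) =
      -(2 * Real.pi * ħ)⁻¹ * ∑ j, p j * x j := by
    rw [inner_smul_right]; rfl
  rw [h1]
  have hħ' : (ħ : ℂ) ≠ 0 := by exact_mod_cast hħ.ne'
  have hpi : (Real.pi : ℂ) ≠ 0 := by exact_mod_cast Real.pi_ne_zero
  push_cast
  field_simp
  ring

/-- The orthogonality relation for fixed `q`, which is Plancherel's theorem in `p`. -/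
theorem integral_conj_ambiguity_fiber {ħ : ℝ} (hħ : 0 < ħ) (f u g v : 𝓢(Config n, ℂ))
    (q : Config n) :
    ∫ p, ambiguity ħ f u (prodEquivPhase n (q, p)) *
        (starRingEnd ℂ) (ambiguity ħ g v (prodEquivPhase n (q, p))) =
      (((2 * Real.pi * ħ) ^ n : ℝ) : ℂ) *
        ∫ x, (starRingEnd ℂ) (f x) * g x * (u (x - q) * (starRingEnd ℂ) (v (x - q))) := by
  have h1 : ∀ p, ambiguity ħ f u (prodEquivPhase n (q, p)) *
        (starRingEnd ℂ) (ambiguity ħ g v (prodEquivPhase n (q, p))) =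
      (fun ξ => inner ℂ (FourierTransform.fourier (shiftProd g v q) ξ)
        (FourierTransform.fourier (shiftProd f u q) ξ)) ((-(2 * Real.pi * ħ)⁻¹ : ℝ) • p) := by
    intro p
    rw [ambiguity_prodEquivPhase hħ, ambiguity_prodEquivPhase hħ, map_mul, conj_phase]
    simp only [RCLike.inner_apply]
    linear_combination (FourierTransform.fourier (shiftProd f u q)
      ((-(2 * Real.pi * ħ)⁻¹ : ℝ) • p) * (starRingEnd ℂ) (FourierTransform.fourier (shiftProd g v q)
      ((-(2 * Real.pi * ħ)⁻¹ : ℝ) • p))) * phase_mul_phase_neg ħ (-∑ j, p j * q j)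
  rw [integral_congr_ae (Filter.Eventually.of_forall h1),
    Measure.integral_comp_smul volume (fun ξ => inner ℂ
      (FourierTransform.fourier (shiftProd g v q) ξ)
      (FourierTransform.fourier (shiftProd f u q) ξ)), SchwartzMap.integral_inner_fourier_fourier]
  have hc : 0 < 2 * Real.pi * ħ := by positivity
  have h2 : |((-(2 * Real.pi * ħ)⁻¹) ^ Module.finrank ℝ (Config n))⁻¹| = (2 * Real.pi * ħ) ^ n := by
    rw [finrank_euclideanSpace, Fintype.card_fin, abs_inv, abs_pow, abs_neg, abs_inv,
      abs_of_pos hc, inv_pow, inv_inv]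
  rw [h2, Complex.real_smul]
  congr 1
  refine integral_congr_ae (Filter.Eventually.of_forall fun x => ?_)
  simp only [RCLike.inner_apply, shiftProd_apply, map_mul, Complex.conj_conj]
  ring

theorem integrable_conj_mul (f g : 𝓢(Config n, ℂ)) :
    Integrable (fun x => (starRingEnd ℂ) (f x) * g x) volume := by
  refine ((shiftProd f g 0).integrable (μ := volume)).congr
    (Filter.Eventually.of_forall fun x => ?_)
  simp only [shiftProd_apply, sub_zero]

theorem integrable_ambiguity_mul_conj {ħ : ℝ} (hħ : 0 < ħ) (f u g v : 𝓢(Config n, ℂ)) :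
    Integrable (fun z => ambiguity ħ f u z * (starRingEnd ℂ) (ambiguity ħ g v z)) volume := by
  refine (integrable_ambiguity hħ f u).mul_bdd
    (Complex.continuous_conj.comp (continuous_ambiguity hħ g v)).aestronglyMeasurable
    (c := ‖state g‖ * ‖state v‖) (Filter.Eventually.of_forall fun z => ?_)
  rw [RCLike.norm_conj]
  exact norm_ambiguity_le ħ g v z

/-- The orthogonality relations (Moyal's identity) for Schwartz functions. -/
theorem integral_ambiguity_mul_conj {ħ : ℝ} (hħ : 0 < ħ) (f u g v : 𝓢(Config n, ℂ)) :
    ∫ z, ambiguity ħ f u z * (starRingEnd ℂ) (ambiguity ħ g v z) =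
      (((2 * Real.pi * ħ) ^ n : ℝ) : ℂ) *
        (inner ℂ (state f) (state g) * inner ℂ (state v) (state u)) := by
  have hint := integrable_ambiguity_mul_conj hħ f u g v
  rw [← (measurePreserving_prodEquivPhase n).integrable_comp_emb
    (prodEquivPhase n).measurableEmbedding] at hint
  rw [← (measurePreserving_prodEquivPhase n).integral_comp
    (prodEquivPhase n).measurableEmbedding]
  refine (integral_prod _ hint).trans ?_
  simp only [Function.comp_apply, integral_conj_ambiguity_fiber hħ, integral_const_mul]
  congr 1
  -- The integral over `q` and `x` is that of a convolution.
  have h := integral_convolution (μ := (volume : Measure (Config n))) (ν := volume)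
    (ContinuousLinearMap.mul ℝ ℂ) (integrable_conj_mul f g) (integrable_conj_mul v u).comp_neg
  simp only [convolution_def, ContinuousLinearMap.mul_apply', integral_neg_eq_self
    (fun x => (starRingEnd ℂ) (v x) * u x), ← inner_state, neg_sub] at h
  rw [← h]
  refine integral_congr_ae (Filter.Eventually.of_forall fun q => ?_)
  refine integral_congr_ae (Filter.Eventually.of_forall fun x => ?_)
  simp only
  ring

/-- The orthogonality relations, with one of the four states an arbitrary element of `L²`. -/
theorem integral_inner_weylHeisenberg_mul_conj {ħ : ℝ} (hħ : 0 < ħ) (h : QState n)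
    (u g v : 𝓢(Config n, ℂ)) :
    ∫ z, inner ℂ h (weylHeisenberg ħ z (state u)) * (starRingEnd ℂ) (ambiguity ħ g v z) =
      (((2 * Real.pi * ħ) ^ n : ℝ) : ℂ) *
        (inner ℂ h (state g) * inner ℂ (state v) (state u)) := by
  refine dense_range_state.induction_on (p := fun h : QState n =>
    ∫ z, inner ℂ h (weylHeisenberg ħ z (state u)) * (starRingEnd ℂ) (ambiguity ħ g v z) =
      (((2 * Real.pi * ħ) ^ n : ℝ) : ℂ) *
        (inner ℂ h (state g) * inner ℂ (state v) (state u))) h ?_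
    fun f => integral_ambiguity_mul_conj hħ f u g v
  refine isClosed_eq ?_ (by fun_prop)
  refine continuous_iff_continuousAt.2 fun h₀ => ?_
  refine continuousAt_of_dominated (bound := fun z =>
    (‖h₀‖ + 1) * ‖state u‖ * ‖ambiguity ħ g v z‖) ?_ ?_ ?_ ?_
  · refine Filter.Eventually.of_forall fun h => Continuous.aestronglyMeasurable ?_
    exact (continuous_const.inner (continuous_weylHeisenberg hħ _)).mul
      (Complex.continuous_conj.comp (continuous_ambiguity hħ g v))
  · filter_upwards [Metric.ball_mem_nhds h₀ one_pos] with h hh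
    refine Filter.Eventually.of_forall fun z => ?_
    rw [norm_mul, RCLike.norm_conj]
    refine mul_le_mul_of_nonneg_right ((norm_inner_le_norm _ _).trans ?_) (norm_nonneg _)
    rw [LinearIsometry.norm_map]
    refine mul_le_mul_of_nonneg_right ?_ (norm_nonneg _)
    have h1 := norm_le_norm_add_norm_sub h₀ h
    have h2 : ‖h - h₀‖ < 1 := by rwa [← dist_eq_norm]
    rw [norm_sub_rev] at h1
    linarith [norm_sub_rev h h₀, norm_le_norm_add_norm_sub' h h₀]
  · exact (integrable_ambiguity hħ g v).norm.const_mul _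
  · refine Filter.Eventually.of_forall fun z => ?_
    fun_prop

/-! ### Uniqueness of the covariant symbol -/

/-- The integrals `∫ G(z) exp (i σ(z, w) / ħ) dz` are the values of the Fourier transform of `G`, up
to a linear change of the variable `w`. -/
theorem ae_eq_zero_of_integral_mul_phase_eq_zero {ħ : ℝ} (hħ : 0 < ħ) {G : Phase n → ℂ}
    (hG : Integrable G volume)
    (h : ∀ w, ∫ z, G z * phase ħ (2 * sympForm z w) = 0) : G =ᵐ[volume] 0 := by
  have he := PiLp.volume_preserving_ofLp (Fin n ⊕ Fin n)
  have hemb : MeasurableEmbedding (@WithLp.ofLp 2 (Fin n ⊕ Fin n → ℝ)) :=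
    (MeasurableEquiv.toLp 2 (Fin n ⊕ Fin n → ℝ)).symm.measurableEmbedding
  have h1 : Integrable (G ∘ @WithLp.ofLp 2 (Fin n ⊕ Fin n → ℝ)) volume :=
    (he.integrable_comp_emb hemb).2 hG
  have h2 := h1.ae_eq_zero_of_fourier_eq_zero fun ξ => by
    rw [Real.fourier_eq', ← h (J n *ᵥ ((-(2 * Real.pi * ħ)) • ξ.ofLp)), ← he.integral_comp hemb]
    refine integral_congr_ae (Filter.Eventually.of_forall fun x => ?_)
    simp only [smul_eq_mul, Function.comp_apply, sympForm_J_mulVec, dotProduct_smul]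
    rw [mul_comm, phase_eq]
    congr 4
    have h3 : inner ℝ x ξ = x.ofLp ⬝ᵥ ξ.ofLp := by
      rw [EuclideanSpace.inner_eq_star_dotProduct, dotProduct_comm]; rfl
    rw [h3]
    field_simp
  have h3 := (PiLp.volume_preserving_toLp (Fin n ⊕ Fin n)).quasiMeasurePreserving.ae_eq_comp h2
  filter_upwards [h3] with z hz
  simpa using hz

theorem ambiguity_weylSchwartz (ħ : ℝ) (f g : 𝓢(Config n, ℂ)) (w z : Phase n) :
    ambiguity ħ (weylSchwartz ħ w f) (weylSchwartz ħ w g) z =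
      phase ħ (2 * sympForm z w) * ambiguity ħ f g z := by
  rw [ambiguity, ← weylHeisenberg_state, ← weylHeisenberg_state, inner_weylHeisenberg_left,
    weylHeisenberg_comp, weylHeisenberg_comp, smul_smul, ← phase_add, inner_smul_right,
    ambiguity, sympForm_add_left, sympForm_neg_left, sympForm_neg_left, sympForm_self,
    sympForm_swap z w]
  congr 2
  · ring
  · congr 3; abel

theorem exists_state_ne_zero : ∃ u : 𝓢(Config n, ℂ), state u ≠ 0 := by
  let b : ContDiffBump (0 : Config n) := default
  have h1 : HasCompactSupport fun x => (b x : ℂ) :=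
    b.hasCompactSupport.comp_left Complex.ofReal_zero
  have h2 : ContDiff ℝ (⊤ : ℕ∞) fun x => (b x : ℂ) := Complex.ofRealCLM.contDiff.comp b.contDiff
  refine ⟨h1.toSchwartzMap h2, fun h => ?_⟩
  have h3 : h1.toSchwartzMap h2 = 0 := SchwartzMap.injective_toLp 2 volume
    (h.trans (map_zero (SchwartzMap.toLpCLM ℂ ℂ 2 (volume : Measure (Config n)))).symm)
  have h4 : ((b 0 : ℝ) : ℂ) = 0 := DFunLike.congr_fun h3 0
  rw [b.one_of_mem_closedBall (Metric.mem_closedBall_self b.rIn_pos.le)] at h4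
  simp at h4

/-- An operator has at most one covariant symbol, up to null sets. -/
theorem IsCovariantSymbol.ae_eq {ħ : ℝ} (hħ : 0 < ħ) {R : QState n →L[ℂ] QState n}
    {Ω Ω' : Phase n → ℂ} (h : IsCovariantSymbol ħ R Ω) (h' : IsCovariantSymbol ħ R Ω') :
    Ω' =ᵐ[volume] Ω := by
  have key : ∀ f g : 𝓢(Config n, ℂ),
      (fun z => (Ω' z - Ω z) * ambiguity ħ f g z) =ᵐ[volume] 0 := by
    have hint : ∀ f g : 𝓢(Config n, ℂ),
        Integrable (fun z => (Ω' z - Ω z) * ambiguity ħ f g z) volume ∧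
        ∫ z, (Ω' z - Ω z) * ambiguity ħ f g z = 0 := by
      intro f g
      obtain ⟨h1, h2⟩ := h f g
      obtain ⟨h1', h2'⟩ := h' f g
      simp only [sub_mul, ambiguity]
      refine ⟨h1'.sub h1, ?_⟩
      rw [integral_sub h1' h1, sub_eq_zero]
      have hc : (((2 * Real.pi * ħ) ^ n : ℝ) : ℂ)⁻¹ ≠ 0 := by
        exact inv_ne_zero (Complex.ofReal_ne_zero.2 (by positivity))
      exact mul_left_cancel₀ hc (h2'.symm.trans h2)
    intro f g
    refine ae_eq_zero_of_integral_mul_phase_eq_zero hħ (hint f g).1 fun w => ?_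
    rw [← (hint (weylSchwartz ħ w f) (weylSchwartz ħ w g)).2]
    refine integral_congr_ae (Filter.Eventually.of_forall fun z => ?_)
    simp only [ambiguity_weylSchwartz]
    ring
  obtain ⟨u, hu⟩ := exists_state_ne_zero (n := n)
  have hall := ae_all_iff.2 fun k : ℕ =>
    key (weylSchwartz ħ (TopologicalSpace.denseSeq (Phase n) k) u) u
  filter_upwards [hall] with z hz
  -- Near `z` there is a point `w` of the dense sequence with `⟨T(w) u, T(z) u⟩ ≠ 0`.
  have hcont : Continuous fun w =>
      inner ℂ (weylHeisenberg ħ w (state u)) (weylHeisenberg ħ z (state u)) :=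
    (continuous_weylHeisenberg hħ _).inner continuous_const
  have hopen : IsOpen {w | inner ℂ (weylHeisenberg ħ w (state u))
      (weylHeisenberg ħ z (state u)) ≠ 0} := isOpen_ne_fun hcont continuous_const
  obtain ⟨k, hk⟩ := (TopologicalSpace.denseRange_denseSeq (Phase n)).exists_mem_open hopen
    ⟨z, by simpa [LinearIsometry.inner_map_map] using hu⟩
  have := hz k
  simp only [Pi.zero_apply, mul_eq_zero, sub_eq_zero] at this
  refine this.resolve_right ?_
  rwa [ambiguity, ← weylHeisenberg_state]

/-! ### The Cayley transform of a symplectic matrix -/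

theorem isUnit_det_sub_one {M : PhaseMatrix n}
    (h1 : ¬ Module.End.HasEigenvalue (Matrix.toLin' M) 1) : IsUnit (M - 1).det := by
  rw [isUnit_iff_ne_zero]
  intro h
  obtain ⟨v, hv, hv'⟩ := Matrix.exists_mulVec_eq_zero_iff.2 h
  refine h1 (Module.End.hasEigenvalue_of_hasEigenvector (x := v) ⟨?_, hv⟩)
  rw [Module.End.mem_eigenspace_iff, Matrix.toLin'_apply, one_smul]
  rwa [Matrix.sub_mulVec, Matrix.one_mulVec, sub_eq_zero] at hv'

theorem cayley_eq {M : PhaseMatrix n} (h1 : IsUnit (M - 1).det) :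
    cayley M = (1 / 2 : ℝ) • J n + J n * (M - 1)⁻¹ := by
  have h2 : (M - 1)⁻¹ * (M - 1) = 1 := Matrix.nonsing_inv_mul _ h1
  have h3 : J n * (M - 1)⁻¹ * (1 + M) = J n * ((M - 1)⁻¹ * (M - 1)) + 2 • (J n * (M - 1)⁻¹) := by
    noncomm_ring
  rw [cayley, h3, h2, mul_one, smul_add]
  congr 1
  rw [← Nat.cast_smul_eq_nsmul ℝ, smul_smul]
  norm_num

theorem isSymm_cayley {M : PhaseMatrix n} (hM : M ∈ Matrix.symplecticGroup (Fin n) ℝ)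
    (h1 : IsUnit (M - 1).det) : (cayley M).IsSymm := by
  set N := (M - 1)⁻¹ with hN
  have h2 : (M - 1) * N = 1 := Matrix.mul_nonsing_inv _ h1
  have h3 : Nᵀ * (M - 1)ᵀ = 1 := by rw [← Matrix.transpose_mul, h2, Matrix.transpose_one]
  have h4 : (M - 1)ᵀ * J n + J n * (M - 1) + (M - 1)ᵀ * J n * (M - 1) = 0 := by
    have : (M - 1)ᵀ * J n + J n * (M - 1) + (M - 1)ᵀ * J n * (M - 1) = Mᵀ * J n * M - J n := by
      rw [Matrix.transpose_sub, Matrix.transpose_one]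
      noncomm_ring
    rw [this, transpose_mul_J_mul hM, sub_self]
  have h5 : J n * N + Nᵀ * J n + J n = 0 := by
    calc J n * N + Nᵀ * J n + J n
        = (Nᵀ * (M - 1)ᵀ) * J n * N + Nᵀ * J n * ((M - 1) * N)
          + (Nᵀ * (M - 1)ᵀ) * J n * ((M - 1) * N) := by rw [h2, h3]; simp
      _ = Nᵀ * ((M - 1)ᵀ * J n + J n * (M - 1) + (M - 1)ᵀ * J n * (M - 1)) * N := by
          noncomm_ring
      _ = 0 := by rw [h4]; simp
  rw [Matrix.IsSymm, cayley_eq h1, Matrix.transpose_add, Matrix.transpose_smul,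
    Matrix.transpose_mul, J_transpose, ← hN, ← sub_eq_zero]
  have h6 : (1 / 2 : ℝ) • -J n + Nᵀ * -J n - ((1 / 2 : ℝ) • J n + J n * N) =
      -(J n * N + Nᵀ * J n + J n) := by
    rw [mul_neg]; module
  rw [h6, h5, neg_zero]

theorem dotProduct_cayley_mulVec {M : PhaseMatrix n} (h1 : IsUnit (M - 1).det) (y : Phase n) :
    y ⬝ᵥ (cayley M *ᵥ y) = sympForm ((M - 1)⁻¹ *ᵥ y) y := by
  have h2 : y ⬝ᵥ (J n *ᵥ y) = 0 := by
    rw [dotProduct_comm]; exact sympForm_self y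
  rw [cayley_eq h1, Matrix.add_mulVec, Matrix.smul_mulVec, dotProduct_add, dotProduct_smul, h2,
    smul_zero, zero_add, ← Matrix.mulVec_mulVec, dotProduct_comm, sympForm]

/-! ### The symbol of an operator that is covariant under a symplectic matrix -/

/-- The phase `exp ((i / 2 ħ) y ⬝ A y)` of the Mehlig-Wilkinson formula. -/
def cayleyPhase (ħ : ℝ) (M : PhaseMatrix n) (y : Phase n) : ℂ :=
  phase ħ (y ⬝ᵥ (cayley M *ᵥ y))

theorem continuous_cayleyPhase (ħ : ℝ) (M : PhaseMatrix n) : Continuous (cayleyPhase ħ M) := by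
  refine (continuous_phase ħ).comp ?_
  exact Continuous.dotProduct continuous_id (Continuous.matrix_mulVec continuous_const continuous_id)

theorem norm_cayleyPhase (ħ : ℝ) (M : PhaseMatrix n) (y : Phase n) : ‖cayleyPhase ħ M y‖ = 1 :=
  norm_phase _ _

theorem cayleyPhase_neg (ħ : ℝ) (M : PhaseMatrix n) (y : Phase n) :
    cayleyPhase ħ M (-y) = cayleyPhase ħ M y := by
  simp [cayleyPhase, Matrix.mulVec_neg]

/-- The matrix element `⟨T(w) v, R T(w) u⟩` of a conjugate of `R`; its integral over `w` plays the
role of the trace of `R`. -/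
def conjElement (ħ : ℝ) (R : QState n ≃ₗᵢ[ℂ] QState n) (v u : 𝓢(Config n, ℂ)) (w : Phase n) : ℂ :=
  inner ℂ (weylHeisenberg ħ w (state v)) (R (weylHeisenberg ħ w (state u)))

theorem continuous_conjElement {ħ : ℝ} (hħ : 0 < ħ) (R : QState n ≃ₗᵢ[ℂ] QState n)
    (v u : 𝓢(Config n, ℂ)) : Continuous (conjElement ħ R v u) :=
  (continuous_weylHeisenberg hħ _).inner (R.continuous.comp (continuous_weylHeisenberg hħ _))

section Covariant

variable {ħ : ℝ} {M : PhaseMatrix n} {R : QState n ≃ₗᵢ[ℂ] QState n}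

theorem mulVec_eq_add_of_sub_one (M : PhaseMatrix n) (w : Phase n) :
    M *ᵥ w = w + (M - 1) *ᵥ w := by
  rw [Matrix.sub_mulVec, Matrix.one_mulVec]; abel

theorem sub_one_mulVec_inv (h1 : IsUnit (M - 1).det) (y : Phase n) :
    (M - 1) *ᵥ ((M - 1)⁻¹ *ᵥ y) = y := by
  rw [Matrix.mulVec_mulVec, Matrix.mul_nonsing_inv _ h1, Matrix.one_mulVec]

theorem inv_mulVec_sub_one (h1 : IsUnit (M - 1).det) (w : Phase n) :
    (M - 1)⁻¹ *ᵥ ((M - 1) *ᵥ w) = w := by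
  rw [Matrix.mulVec_mulVec, Matrix.nonsing_inv_mul _ h1, Matrix.one_mulVec]

/-- In terms of `y = (M - 1) w`, the element `⟨T(w) v, R T(w) u⟩` is an ambiguity function. -/
theorem conjElement_eq_ambiguity
    (hcov : ∀ z f, R (weylHeisenberg ħ z f) = weylHeisenberg ħ (M *ᵥ z) (R f))
    (h1 : IsUnit (M - 1).det) {v u a : 𝓢(Config n, ℂ)} (ha : R (state u) = state a) (w : Phase n) :
    conjElement ħ R v u w = (starRingEnd ℂ) (cayleyPhase ħ M ((M - 1) *ᵥ w)) *
      ambiguity ħ v a ((M - 1) *ᵥ w) := by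
  rw [conjElement, hcov, ha, inner_weylHeisenberg_left, weylHeisenberg_comp, inner_smul_right,
    cayleyPhase, dotProduct_cayley_mulVec h1, inv_mulVec_sub_one h1, conj_phase,
    mulVec_eq_add_of_sub_one, neg_add_cancel_left, sympForm_add_right, sympForm_neg_left,
    sympForm_neg_left, sympForm_self, neg_zero, zero_add, ambiguity]

theorem integrable_conjElement (hħ : 0 < ħ)
    (hcov : ∀ z f, R (weylHeisenberg ħ z f) = weylHeisenberg ħ (M *ᵥ z) (R f))
    (h1 : IsUnit (M - 1).det) {v u a : 𝓢(Config n, ℂ)} (ha : R (state u) = state a) :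
    Integrable (conjElement ħ R v u) volume := by
  have h2 := (Matrix.integrable_comp_mulVec_and_integral h1.ne_zero (ambiguity ħ v a)).1
    (integrable_ambiguity hħ v a)
  refine h2.norm.mono' (continuous_conjElement hħ R v u).aestronglyMeasurable
    (Filter.Eventually.of_forall fun w => ?_)
  rw [conjElement_eq_ambiguity hcov h1 ha, norm_mul, RCLike.norm_conj, norm_cayleyPhase, one_mul]

/-- The integral of `⟨T(w) v, R T(w) u⟩` over `w` in terms of the phase of the symbol. -/
theorem integral_conjElement
    (hcov : ∀ z f, R (weylHeisenberg ħ z f) = weylHeisenberg ħ (M *ᵥ z) (R f))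
    (h1 : IsUnit (M - 1).det) {v u a : 𝓢(Config n, ℂ)} (ha : R (state u) = state a) :
    ∫ w, conjElement ħ R v u w = ((|(M - 1).det|⁻¹ : ℝ) : ℂ) *
      (starRingEnd ℂ) (∫ y, cayleyPhase ħ M y * ambiguity ħ a v y) := by
  rw [funext fun w => conjElement_eq_ambiguity (v := v) hcov h1 ha w,
    (Matrix.integrable_comp_mulVec_and_integral h1.ne_zero (fun y =>
      (starRingEnd ℂ) (cayleyPhase ħ M y) * ambiguity ħ v a y)).2, ← integral_conj,
    ← integral_neg_eq_self]
  congr 1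
  refine integral_congr_ae (Filter.Eventually.of_forall fun y => ?_)
  simp only [cayleyPhase_neg, map_mul]
  congr 1
  rw [ambiguity, ambiguity, ← inner_weylHeisenberg_left, inner_conj_symm]

/-- Inserting `T(-y)` in front of `R` in `⟨T(w) v, R T(w) u⟩` amounts to a phase and to a shift
of `w`. -/
theorem inner_weylHeisenberg_neg_conj
    (hcov : ∀ z f, R (weylHeisenberg ħ z f) = weylHeisenberg ħ (M *ᵥ z) (R f))
    (h1 : IsUnit (M - 1).det) (v u : 𝓢(Config n, ℂ)) (w y : Phase n) :
    inner ℂ (weylHeisenberg ħ w (state v))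
        (weylHeisenberg ħ (-y) (R (weylHeisenberg ħ w (state u)))) =
      cayleyPhase ħ M y * conjElement ħ R v u (w - (M - 1)⁻¹ *ᵥ y) := by
  set w₀ := (M - 1)⁻¹ *ᵥ y with hw₀
  obtain ⟨w₁, rfl⟩ : ∃ w₁, w = w₀ + w₁ := ⟨w - w₀, by abel⟩
  -- `T(w₀) T(w₁)` differs from `T(w₀ + w₁)` by a phase, which drops out.
  have hsplit : ∀ f : QState n, weylHeisenberg ħ (w₀ + w₁) f =
      phase ħ (-sympForm w₀ w₁) • weylHeisenberg ħ w₀ (weylHeisenberg ħ w₁ f) := by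
    intro f
    rw [weylHeisenberg_comp, smul_smul, mul_comm, phase_mul_phase_neg, one_smul]
  have hM : M *ᵥ w₀ = w₀ + y := by
    rw [mulVec_eq_add_of_sub_one, hw₀, sub_one_mulVec_inv h1]
  have hmid : ∀ f : QState n, weylHeisenberg ħ (-w₀) (weylHeisenberg ħ (-y)
      (weylHeisenberg ħ (w₀ + y) f)) = cayleyPhase ħ M y • f := by
    intro f
    rw [weylHeisenberg_comp ħ (-w₀), sympForm_neg_left, sympForm_neg_right, neg_neg,
      show -w₀ + -y = -(w₀ + y) by abel, weylHeisenberg_neg_apply, cayleyPhase,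
      dotProduct_cayley_mulVec h1]
  rw [hsplit, hsplit, map_smul, map_smul, inner_smul_left, inner_smul_right, conj_phase, ← mul_assoc,
    neg_neg, phase_mul_phase_neg, one_mul, inner_weylHeisenberg_left, hcov, hM, hmid,
    inner_smul_right, add_sub_cancel_left, conjElement]

/-- The integrand of the orthogonality relation for `⟨f, T(M w) R u⟩⟨v, T(-w) g⟩`, at the point
`y - (M - 1) w`. -/
theorem ambiguity_mul_conj_shear
    (hcov : ∀ z f, R (weylHeisenberg ħ z f) = weylHeisenberg ħ (M *ᵥ z) (R f))
    (h1 : IsUnit (M - 1).det) {u a : 𝓢(Config n, ℂ)} (ha : R (state u) = state a)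
    (f g v : 𝓢(Config n, ℂ)) (w y : Phase n) :
    ambiguity ħ (weylSchwartz ħ (-(M *ᵥ w)) f) (weylSchwartz ħ (-w) g) (y - (M - 1) *ᵥ w) *
        (starRingEnd ℂ) (ambiguity ħ a v (y - (M - 1) *ᵥ w)) =
      cayleyPhase ħ M y * ambiguity ħ f g y * conjElement ħ R v u (w - (M - 1)⁻¹ *ᵥ y) := by
  set z := y - (M - 1) *ᵥ w with hz
  set θ := sympForm (-(M *ᵥ w)) y + sympForm (-(M *ᵥ w) + y) w with hθ
  have hT : ∀ k : QState n, weylHeisenberg ħ (-(M *ᵥ w)) (weylHeisenberg ħ y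
      (weylHeisenberg ħ w k)) = phase ħ θ • weylHeisenberg ħ z k := by
    intro k
    rw [weylHeisenberg_comp, weylHeisenberg_comp, smul_smul, ← phase_add, hθ, hz]
    congr 3
    rw [mulVec_eq_add_of_sub_one]; abel
  have hT' : ∀ k : QState n, weylHeisenberg ħ z k = phase ħ (-θ) •
      weylHeisenberg ħ (-(M *ᵥ w)) (weylHeisenberg ħ y (weylHeisenberg ħ w k)) := by
    intro k
    rw [hT, smul_smul, mul_comm, phase_mul_phase_neg, one_smul]
  have e1 : ambiguity ħ (weylSchwartz ħ (-(M *ᵥ w)) f) (weylSchwartz ħ (-w) g) z =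
      phase ħ (-θ) * ambiguity ħ f g y := by
    rw [ambiguity, ← weylHeisenberg_state, ← weylHeisenberg_state, hT', weylHeisenberg_apply_neg,
      inner_smul_right, LinearIsometry.inner_map_map, ambiguity]
  have e2 : (starRingEnd ℂ) (ambiguity ħ a v z) = phase ħ θ *
      (cayleyPhase ħ M y * conjElement ħ R v u (w - (M - 1)⁻¹ *ᵥ y)) := by
    rw [ambiguity, inner_conj_symm, hT', inner_smul_left, conj_phase, neg_neg, ← ha,
      inner_weylHeisenberg_left, neg_neg, inner_weylHeisenberg_left, ← hcov,
      inner_weylHeisenberg_neg_conj hcov h1]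
  rw [e1, e2]
  linear_combination (ambiguity ħ f g y * cayleyPhase ħ M y *
    conjElement ħ R v u (w - (M - 1)⁻¹ *ᵥ y)) * phase_mul_phase_neg ħ θ

/-- The symbol of a unitary operator that is covariant under `M` is proportional to the phase
`exp ((i / 2 ħ) y ⬝ A y)`. -/
theorem integral_cayleyPhase_mul_ambiguity (hħ : 0 < ħ)
    (hcov : ∀ z f, R (weylHeisenberg ħ z f) = weylHeisenberg ħ (M *ᵥ z) (R f))
    (h1 : IsUnit (M - 1).det) {u a : 𝓢(Config n, ℂ)} (ha : R (state u) = state a)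
    (f g v : 𝓢(Config n, ℂ)) :
    (∫ y, cayleyPhase ħ M y * ambiguity ħ f g y) * ∫ w, conjElement ħ R v u w =
      (((2 * Real.pi * ħ) ^ n : ℝ) : ℂ) ^ 2 *
        (inner ℂ (state f) (R (state g)) * inner ℂ (state v) (state u)) := by
  set c : ℂ := (((2 * Real.pi * ħ) ^ n : ℝ) : ℂ) with hc
  set k := conjElement ħ R v u with hk
  have hkc : Continuous k := continuous_conjElement hħ R v u
  have hki : Integrable k volume := integrable_conjElement hħ hcov h1 ha
  set V : Phase n → ℂ := fun y => cayleyPhase ħ M y * ambiguity ħ f g y with hV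
  have hVc : Continuous V := (continuous_cayleyPhase ħ M).mul (continuous_ambiguity hħ f g)
  have hVi : Integrable V volume :=
    (integrable_ambiguity hħ f g).norm.mono' hVc.aestronglyMeasurable
      (Filter.Eventually.of_forall fun y => by rw [norm_mul, norm_cayleyPhase, one_mul])
  -- the integral over `y`, for fixed `w`
  have hy : ∀ w, ∫ y, V y * k (w - (M - 1)⁻¹ *ᵥ y) =
      c * (inner ℂ (R.symm (state f)) (weylHeisenberg ħ w (state u)) *
        (starRingEnd ℂ) (ambiguity ħ g v w)) := by
    intro w
    have h2 := integral_ambiguity_mul_conj hħ (weylSchwartz ħ (-(M *ᵥ w)) f)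
      (weylSchwartz ħ (-w) g) a v
    rw [← integral_sub_right_eq_self _ ((M - 1) *ᵥ w)] at h2
    simp only [ambiguity_mul_conj_shear hcov h1 ha] at h2
    rw [h2, ← weylHeisenberg_state, ← weylHeisenberg_state, inner_weylHeisenberg_left, neg_neg,
      ← ha, ← hcov, ← inner_weylHeisenberg_left, ambiguity, inner_conj_symm,
      ← R.inner_map_map (R.symm (state f)), R.apply_symm_apply]
  have hint : Integrable (Function.uncurry fun y w => V y * k (w - (M - 1)⁻¹ *ᵥ y))
      ((volume : Measure (Phase n)).prod volume) := by
    have hcont : Continuous (Function.uncurry fun y w => V y * k (w - (M - 1)⁻¹ *ᵥ y)) := by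
      have h3 : Continuous fun x : Phase n × Phase n => (M - 1)⁻¹ *ᵥ x.1 :=
        Continuous.matrix_mulVec continuous_const continuous_fst
      exact (hVc.comp continuous_fst).mul (hkc.comp (continuous_snd.sub h3))
    rw [integrable_prod_iff hcont.aestronglyMeasurable]
    refine ⟨Filter.Eventually.of_forall fun y => ?_, ?_⟩
    · exact (hki.comp_sub_right ((M - 1)⁻¹ *ᵥ y)).const_mul (V y)
    simp only [Function.uncurry_apply_pair, norm_mul, integral_const_mul,
      integral_sub_right_eq_self (fun w => ‖k w‖)]
    exact hVi.norm.mul_const _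
  calc (∫ y, V y) * ∫ w, k w
      = ∫ y, ∫ w, V y * k (w - (M - 1)⁻¹ *ᵥ y) := by
        simp only [integral_const_mul, integral_sub_right_eq_self k, integral_mul_const]
    _ = ∫ w, ∫ y, V y * k (w - (M - 1)⁻¹ *ᵥ y) := integral_integral_swap hint
    _ = c ^ 2 * (inner ℂ (R.symm (state f)) (state g) * inner ℂ (state v) (state u)) := by
        simp only [hy, integral_const_mul, integral_inner_weylHeisenberg_mul_conj hħ]
        ring
    _ = _ := by rw [← R.inner_map_map (R.symm (state f)), R.apply_symm_apply]

end Covariant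

/-- A unitary operator that preserves Schwartz space and is covariant under `M` has, up to a
constant of modulus one, the Mehlig-Wilkinson symbol. -/
theorem exists_isCovariantSymbol {ħ : ℝ} (hħ : 0 < ħ) {M : PhaseMatrix n}
    {R : QState n ≃ₗᵢ[ℂ] QState n}
    (hcov : ∀ z f, R (weylHeisenberg ħ z f) = weylHeisenberg ħ (M *ᵥ z) (R f))
    (hR : ∀ f : 𝓢(Config n, ℂ), ∃ g : 𝓢(Config n, ℂ), R (state f) = state g)
    (h1 : IsUnit (M - 1).det) :
    ∃ γ : ℂ, ‖γ‖ = 1 ∧ IsCovariantSymbol ħ (R : QState n →L[ℂ] QState n) fun z =>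
      γ * ((|(1 - M).det| ^ (-(1 / 2) : ℝ) : ℝ) : ℂ) * cayleyPhase ħ M z := by
  obtain ⟨u, hu⟩ := exists_state_ne_zero (n := n)
  obtain ⟨a, ha⟩ := hR u
  set r : ℝ := ‖state u‖ ^ 2 with hr
  have hr0 : 0 < r := by positivity
  have huu : inner ℂ (state u) (state u) = (r : ℂ) := by
    rw [inner_self_eq_norm_sq_to_K, hr]; push_cast; rfl
  set c : ℝ := (2 * Real.pi * ħ) ^ n with hc
  have hc0 : 0 < c := by positivity
  set d : ℝ := |(M - 1).det| with hd
  have hd0 : 0 < d := abs_pos.2 h1.ne_zero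
  have hdet : |(1 - M).det| = d := by
    rw [hd, ← neg_sub, Matrix.det_neg, abs_mul, abs_pow, abs_neg, abs_one, one_pow, one_mul]
  set K : ℂ := ∫ w, conjElement ħ R u u w with hK
  have hmain : ∀ f g : 𝓢(Config n, ℂ),
      (∫ y, cayleyPhase ħ M y * ambiguity ħ f g y) * K =
        (c : ℂ) ^ 2 * (inner ℂ (state f) (R (state g)) * r) := fun f g => by
    rw [← huu]
    exact integral_cayleyPhase_mul_ambiguity hħ hcov h1 ha f g u
  -- `K` is determined up to a phase by taking `f = R u` and `g = u`.
  set L : ℂ := ∫ y, cayleyPhase ħ M y * ambiguity ħ a u y with hL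
  have hKL : K = ((d⁻¹ : ℝ) : ℂ) * (starRingEnd ℂ) L := integral_conjElement hcov h1 ha
  have hnK : ‖K‖ ^ 2 * d = (c * r) ^ 2 := by
    have h2 := hmain a u
    rw [← ha, LinearIsometryEquiv.inner_map_map, huu] at h2
    have h3 : ‖L‖ * ‖K‖ = c ^ 2 * (r * r) := by
      have := congrArg norm h2
      rw [norm_mul] at this
      rw [this]
      simp only [norm_mul, norm_pow, Complex.norm_real, Real.norm_of_nonneg hc0.le,
        Real.norm_of_nonneg hr0.le]
    have h4 : ‖L‖ = d * ‖K‖ := by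
      rw [hKL, norm_mul, RCLike.norm_conj, Complex.norm_real, Real.norm_of_nonneg (by positivity),
        mul_inv_cancel_left₀ hd0.ne']
    rw [h4] at h3
    linear_combination h3
  have hs : d ^ (-(1 / 2) : ℝ) = (√d)⁻¹ := by rw [Real.rpow_neg hd0.le, Real.sqrt_eq_rpow]
  have hsd : 0 < √d := Real.sqrt_pos.2 hd0
  refine ⟨K * ((√d / (c * r) : ℝ) : ℂ), ?_, fun f g => ⟨?_, ?_⟩⟩
  · have h5 : ‖K‖ * √d = c * r := by
      rw [← Real.sqrt_sq (norm_nonneg K), ← Real.sqrt_mul (by positivity), hnK,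
        Real.sqrt_sq (by positivity)]
    rw [norm_mul, Complex.norm_real, Real.norm_of_nonneg (by positivity), mul_div_assoc', h5,
      div_self (by positivity)]
  · change Integrable (fun z => _ * ambiguity ħ f g z) volume
    simp only [mul_assoc]
    refine (((integrable_ambiguity hħ f g).bdd_mul (c := 1)
      (continuous_cayleyPhase ħ M).aestronglyMeasurable
      (Filter.Eventually.of_forall fun y => (norm_cayleyPhase ħ M y).le)).const_mul _).const_mul _
      |>.const_mul _
  · change inner ℂ (state f) (R (state g)) = (c : ℂ)⁻¹ * ∫ z, _ * ambiguity ħ f g z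
    simp only [mul_assoc, integral_const_mul, hdet, hs]
    have h6 := hmain f g
    have hc' : (c : ℂ) ≠ 0 := by exact_mod_cast hc0.ne'
    have hr' : (r : ℂ) ≠ 0 := by exact_mod_cast hr0.ne'
    have hs' : ((√d : ℝ) : ℂ) ≠ 0 := by exact_mod_cast hsd.ne'
    push_cast
    field_simp
    linear_combination -h6

end MehligWilkinson

end

theorem theorem2p2 (n : ℕ) (ħ : ℝ) (hħ : 0 < ħ)
    (M : MehligWilkinson.PhaseMatrix n) (hM : M ∈ Matrix.symplecticGroup (Fin n) ℝ)
    (h1 : ¬ Module.End.HasEigenvalue (Matrix.toLin' M) 1)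
    (R : MehligWilkinson.QState n ≃ₗᵢ[ℂ] MehligWilkinson.QState n)
    (hR : MehligWilkinson.IsMetaplecticOperator ħ M R) :
    (MehligWilkinson.cayley M).IsSymm ∧
    ∃ γ : ℂ, ‖γ‖ = 1 ∧
      ∃ Ω : MehligWilkinson.Phase n → ℂ,
        (∀ z, Ω z = γ * ((|(1 - M).det| ^ (-(1 / 2) : ℝ) : ℝ) : ℂ) *
          Complex.exp (Complex.I / (2 * (ħ : ℂ)) *
            ((z ⬝ᵥ (MehligWilkinson.cayley M *ᵥ z) : ℝ) : ℂ))) ∧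
        MehligWilkinson.IsCovariantSymbol ħ (R : _ →L[ℂ] _) Ω ∧
        ∀ Ω' : MehligWilkinson.Phase n → ℂ,
          MehligWilkinson.IsCovariantSymbol ħ (R : _ →L[ℂ] _) Ω' → Ω' =ᵐ[volume] Ω := by
  have hdet := MehligWilkinson.isUnit_det_sub_one h1
  obtain ⟨γ, hγ, hΩ⟩ := MehligWilkinson.exists_isCovariantSymbol hħ
    (hR.map_weylHeisenberg hħ) hR.map_state hdet
  exact ⟨MehligWilkinson.isSymm_cayley hM hdet, γ, hγ, _, fun _ => rfl, hΩ, fun _ => hΩ.ae_eq hħ⟩
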